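/- Fix $C>1$ and $c>0$. There are constants $c_0,c_1,c_2,c_4,c_5,c_6>0$, depending only on $C$ and $c$, such that the following holds. Let $n<m$, $2\le k<n/\log^{2c_1}m$, $\eta_0,\gamma_0\in(0,1)$, $q_{\min}\in(0,1]$, put $\kappa_0:=c_0\,\gamma_0\,q_{\min}\log^{-c_1}m$, and let $$N\ \ge\ \frac{c_2\,k\,n\,m\,\log^{c_1}m\,\log(1/\kappa_0)}{\eta_0^{3}\,\gamma_0\,q_{\min}} .$$ Then there is an algorithm (a finite procedure using real constants, arithmetic operations, square roots and comparisons on the entries of the given samples; no running time is claimed), which may depend on $C,c,n,m,k,N,\eta_0,\gamma_0,q_{\min}$ only, with the following property. Suppose that * $A\in\mathbb R^{n\times m}$ has unit-length columns $A_1,\dots,A_m$ and is $(k,\delta)$-RIP, i.e. $(1-\delta)\|x\|_2\le\|Ax\|_2\le(1+\delta)\|x\|_2$ for every $k$-sparse $x\in\mathbb R^m$, for some $\delta<\dfrac{c_5}{\log(1/\kappa_0)\,\log^{c_6}m}$; * $\mathcal D$ is a spike-and-slab value distribution: a symmetric (hence mean-zero) probability distribution on $[-C,-1]\cup[1,C]$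 with $\mathbb P_{\mathcal D}([1,1+\eta])\ge\gamma_0$ for every $\eta\ge 1/\log^{c}n$; * $S_1,\dots,S_N\subseteq[m]$ are arbitrary supports with $|S_r|\le k$, such that for every $i\in[m]$ and every $T\subseteq[m]\setminus\{i\}$ with $|T|\le c_4\log^{2c_1}m$, at least $q_{\min}N$ of the $S_r$ contain $i$ and are disjoint from $T$. Let $y^{(r)}=Ax^{(r)}$ for $r\in[N]$, where $x^{(r)}$ has support $S_r$ and all nonzero entries of $x^{(1)},\dots,x^{(N)}$ are drawn independently from $\mathcal D$. Then, with probability at least $1-e^{-n}$, the algorithm, given $y^{(1)},\dots,y^{(N)}$, outputs $\widehat A_1,\dots,\widehat A_m\in\mathbb R^n$ such that for some permutation $\sigma$ of $[m]$ and some $b\in\{-1,1\}^m$, $$\|\widehat A_{\sigma(i)}-b_iA_i\|_2\le\eta_0\qquad\text{for all } i\in[m].$$ -/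

import Mathlib

open MeasureTheory

namespace DictLearning

/-- Straight-line real arithmetic on input cells indexed by `ι`: real constants, field
operations and square roots (with Lean's total conventions for `x / 0` and `√x`, `x < 0`). -/
inductive RealTerm (ι : Type) : Type
  | input (i : ι) : RealTerm ι
  | const (c : ℝ) : RealTerm ι
  | add (s t : RealTerm ι) : RealTerm ι
  | sub (s t : RealTerm ι) : RealTerm ι
  | mul (s t : RealTerm ι) : RealTerm ι
  | div (s t : RealTerm ι) : RealTerm ι
  | sqrt (t : RealTerm ι) : RealTerm ι

/-- The value of a term on a given input. -/
noncomputable def RealTerm.eval {ι : Type} (Y : ι → ℝ) : RealTerm ι → ℝ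
  | .input i => Y i
  | .const c => c
  | .add s t => s.eval Y + t.eval Y
  | .sub s t => s.eval Y - t.eval Y
  | .mul s t => s.eval Y * t.eval Y
  | .div s t => s.eval Y / t.eval Y
  | .sqrt t => Real.sqrt (t.eval Y)

/-- An algorithm on real data, as a finite computation tree: it repeatedly compares two terms
in the input and branches on the outcome, and at a leaf it outputs one term for every output
cell. It receives real inputs indexed by `ι` and returns real outputs indexed by `κ`. -/
inductive RealAlgorithm (ι κ : Type) : Type
  | output (t : κ → RealTerm ι) : RealAlgorithm ι κ
  | ifLE (s t : RealTerm ι) (yes no : RealAlgorithm ι κ) : RealAlgorithm ι κ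

open Classical in
/-- The output of an algorithm on a given input. -/
noncomputable def RealAlgorithm.run {ι κ : Type} (Y : ι → ℝ) : RealAlgorithm ι κ → κ → ℝ
  | .output t => fun j => (t j).eval Y
  | .ifLE s t yes no => if s.eval Y ≤ t.eval Y then yes.run Y else no.run Y

/-- An `n × m` dictionary, given by its `m` columns in Euclidean `ℝⁿ`. -/
abbrev Dictionary (n m : ℕ) : Type := Fin m → EuclideanSpace ℝ (Fin n)

/-- The vector `A x = ∑ i, x i • A i`. -/
noncomputable def Dictionary.apply {n m : ℕ} (A : Dictionary n m) (x : Fin m → ℝ) :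
    EuclideanSpace ℝ (Fin n) :=
  ∑ i, x i • A i

/-- The `(k, δ)`-restricted isometry property:
`(1 - δ) ‖x‖ ≤ ‖A x‖ ≤ (1 + δ) ‖x‖` for all `k`-sparse `x`. -/
def Dictionary.IsRIP {n m : ℕ} (A : Dictionary n m) (k : ℕ) (δ : ℝ) : Prop :=
  ∀ x : EuclideanSpace ℝ (Fin m), {i | x i ≠ 0}.ncard ≤ k →
    (1 - δ) * ‖x‖ ≤ ‖A.apply x‖ ∧ ‖A.apply x‖ ≤ (1 + δ) * ‖x‖

/-- A spike-and-slab value distribution for dimension `n`: a symmetric probability measure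
carried by `[-C, -1] ∪ [1, C]` (hence of mean zero) with mass at least `γ₀` on `[1, 1 + η]`
for every `η ≥ 1 / log ^ c n`. -/
structure IsSpikeAndSlab (C c γ₀ : ℝ) (n : ℕ) (D : Measure ℝ) : Prop where
  isProbability : IsProbabilityMeasure D
  symmetric : D.map (fun x => -x) = D
  supported : D (Set.Icc (-C) (-1) ∪ Set.Icc 1 C)ᶜ = 0
  mass_near_one : ∀ η : ℝ, 1 / Real.log n ^ c ≤ η → γ₀ ≤ D.real (Set.Icc 1 (1 + η))

/-- The coefficient vector of a sample: the values `v` on the support `S`, zero elsewhere. -/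
def coeff {m : ℕ} (S : Finset (Fin m)) (v : Fin m → ℝ) : Fin m → ℝ :=
  fun i => if i ∈ S then v i else 0

/-- The observed data: the entries of the samples `y r = A (x r)`, where `x r` has support
`S r` and the values there are the entries `V (r, ·)`. -/
noncomputable def samples {n m N : ℕ} (A : Dictionary n m) (S : Fin N → Finset (Fin m))
    (V : Fin N × Fin m → ℝ) : Fin N × Fin n → ℝ :=
  fun p => A.apply (coeff (S p.1) (fun i => V (p.1, i))) p.2

/-- The array of numbers that an algorithm returned, read as a dictionary. -/
def toDictionary {n m : ℕ} (B : Fin m × Fin n → ℝ) : Dictionary n m :=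
  fun i => WithLp.toLp 2 (fun a => B (i, a))

/-- `B` agrees with `A` column by column within `η₀`, up to signs and the order of columns. -/
def Recovers {n m : ℕ} (η₀ : ℝ) (A B : Dictionary n m) : Prop :=
  ∃ (σ : Equiv.Perm (Fin m)) (b : Fin m → ℝ), (∀ i, b i = 1 ∨ b i = -1) ∧
    ∀ i, ‖B (σ i) - b i • A i‖ ≤ η₀

/-- For every column `i` and every set `T` of at most `t` other columns, at least `q * N` of the
`N` supports contain `i` and are disjoint from `T`. -/
def SupportCondition {m N : ℕ} (q t : ℝ) (S : Fin N → Finset (Fin m)) : Prop :=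
  ∀ (i : Fin m) (T : Finset (Fin m)), i ∉ T → (T.card : ℝ) ≤ t →
    q * N ≤ ({r | i ∈ S r ∧ Disjoint (S r) T}.ncard : ℝ)

end DictLearning

/-! The algorithm is exhaustive search. A finite net of unit-norm RIP dictionaries and a finite net
of codes (`k`-sparse vectors with nonzero entries of size in `[1, C]`) are fixed in advance, and any
net dictionary `B` is returned for which every sample is within `e` of `B c` for some code `c` in
the net. A net point close to `A` almost surely passes this test, so it remains to exclude every net
dictionary that does not recover `A`. The net has at most `(2M+1)^(mn)` members, and a union bound
works once each wrong `B` passes with probability at most `exp(-γ₀ q N / (k+1))`.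

For a wrong `B` there are a column `i` and a bounded set `T` such that every sample whose support
contains `i` and avoids `T` is fitted with probability at most `1 - γ₀/(k+1)`; there are at least `q
N` such samples, and they are independent (`measureReal_fits_le`). Otherwise, for all `i` and `T`,
some such support is fitted with larger probability. Since the distribution is invariant under sign
changes, a union bound over `k+1` sign patterns yields one value vector, with `|x i|` close to `1`,
all of whose `k+1` sign changes are fitted (`exists_flips_mem`).

This forces recovery (`recovers_of_flipCompatible`). Flipping only `i` changes the sample by `2 x i
• A i`, so `A i ≈ B (w i)` with `w i` sparse. Fix a coordinate `l` and let `T` be the boundedly many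
`j ≠ i` with `|w j l|` not small (an approximate Bessel inequality). Flip the elements of `S.erase
i` one by one: the code entry at `l` moves by less than `1` each time, and codes have no entries in
`(-1,0) ∪ (0,1)`, so this entry stays zero or keeps its sign. Flipping `i` last turns the sample
into its negative, hence negates the code approximately. The whole sign reversal therefore happens
in the one step governed by `2 x i * w i l`, which must be almost `0` or of absolute value almost
`2` or more (`entry_dichotomy`). As `|x i| ≈ 1` and `A i` is a unit vector, exactly one entry of `w
i` is large, and `A i` is close to `±B l`. -/

namespace DictLearning

variable {n m N : ℕ}

/-! ### Sparse vectors and restricted isometry -/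

/-- The support of a vector, as a finite set. -/
noncomputable def supp (x : Fin m → ℝ) : Finset (Fin m) := by
  classical exact Finset.univ.filter fun i => x i ≠ 0

@[simp] lemma mem_supp {x : Fin m → ℝ} {i : Fin m} : i ∈ supp x ↔ x i ≠ 0 := by
  simp [supp]

lemma ncard_support (x : Fin m → ℝ) : {i | x i ≠ 0}.ncard = (supp x).card := by
  rw [← Set.ncard_coe_finset]
  congr 1
  ext i
  simp

lemma supp_card_add_le (x y : Fin m → ℝ) :
    (supp (x + y)).card ≤ (supp x).card + (supp y).card := by
  classical
  refine (Finset.card_le_card ?_).trans (Finset.card_union_le _ _)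
  intro i hi
  simp only [Finset.mem_union, mem_supp] at *
  by_contra! h
  simp [h.1, h.2] at hi

lemma supp_card_sub_le (x y : Fin m → ℝ) :
    (supp (x - y)).card ≤ (supp x).card + (supp y).card := by
  classical
  refine (Finset.card_le_card ?_).trans (Finset.card_union_le _ _)
  intro i hi
  simp only [Finset.mem_union, mem_supp] at *
  by_contra! h
  simp [h.1, h.2] at hi

lemma supp_card_smul_le (a : ℝ) (x : Fin m → ℝ) : (supp (a • x)).card ≤ (supp x).card := by
  refine Finset.card_le_card fun i hi => ?_
  simp only [mem_supp, Pi.smul_apply, smul_eq_mul] at *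
  exact right_ne_zero_of_mul hi

lemma Dictionary.apply_add (A : Dictionary n m) (x y : Fin m → ℝ) :
    A.apply (x + y) = A.apply x + A.apply y := by
  simp [Dictionary.apply, add_smul, Finset.sum_add_distrib]

lemma Dictionary.apply_sub (A : Dictionary n m) (x y : Fin m → ℝ) :
    A.apply (x - y) = A.apply x - A.apply y := by
  simp [Dictionary.apply, sub_smul, Finset.sum_sub_distrib]

lemma Dictionary.apply_smul (A : Dictionary n m) (a : ℝ) (x : Fin m → ℝ) :
    A.apply (a • x) = a • A.apply x := by
  simp [Dictionary.apply, Finset.smul_sum, mul_smul]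

lemma Dictionary.apply_single (A : Dictionary n m) (i : Fin m) (a : ℝ) :
    A.apply (Pi.single i a) = a • A i := by
  classical
  simp [Dictionary.apply, Pi.single_apply]

/-- Approximate isometry on sparse vectors, in squared form, together with approximate
orthogonality of the images of disjointly supported sparse vectors. -/
structure Dictionary.NearIsometric (A : Dictionary n m) (s : ℕ) (d : ℝ) : Prop where
  abs_norm_sq_sub_le : ∀ x : EuclideanSpace ℝ (Fin m), (supp x).card ≤ s →
    |‖A.apply x‖ ^ 2 - ‖x‖ ^ 2| ≤ d * ‖x‖ ^ 2
  abs_inner_le : ∀ x y : EuclideanSpace ℝ (Fin m), (supp x).card ≤ s → (supp y).card ≤ s →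
    (∀ i, x i * y i = 0) → |inner ℝ (A.apply x) (A.apply y)| ≤ d * ‖x‖ * ‖y‖

lemma inner_eq_zero_of_disjoint {x y : EuclideanSpace ℝ (Fin m)} (h : ∀ i, x i * y i = 0) :
    inner ℝ x y = 0 := by
  rw [PiLp.inner_apply]
  refine Finset.sum_eq_zero fun i _ => ?_
  simpa [mul_comm] using h i

lemma norm_add_sq_of_disjoint {x y : EuclideanSpace ℝ (Fin m)} (h : ∀ i, x i * y i = 0) :
    ‖x + y‖ ^ 2 = ‖x‖ ^ 2 + ‖y‖ ^ 2 := by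
  rw [norm_add_sq_real, inner_eq_zero_of_disjoint h]; ring

lemma norm_sub_sq_of_disjoint {x y : EuclideanSpace ℝ (Fin m)} (h : ∀ i, x i * y i = 0) :
    ‖x - y‖ ^ 2 = ‖x‖ ^ 2 + ‖y‖ ^ 2 := by
  rw [norm_sub_sq_real, inner_eq_zero_of_disjoint h]; ring

lemma Dictionary.IsRIP.mono {A : Dictionary n m} {k : ℕ} {δ δ' : ℝ} (h : A.IsRIP k δ)
    (hδ : δ ≤ δ') : A.IsRIP k δ' := by
  intro x hx
  obtain ⟨h1, h2⟩ := h x hx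
  constructor <;> nlinarith [norm_nonneg x]

/-- Polarization: `‖y‖ • x` and `‖x‖ • y` have equal norm and disjoint supports, so the RIP bounds
for their sum and difference differ by the factor `(1+δ)² - (1-δ)² = 4δ`. Both have at most `2s ≤ k`
nonzero entries. -/
lemma Dictionary.IsRIP.inner_le {A : Dictionary n m} {k s : ℕ} {δ : ℝ} (h : A.IsRIP k δ)
    (hδ : δ ≤ 1) (hs : 2 * s ≤ k) (x y : EuclideanSpace ℝ (Fin m))
    (hx : (supp x).card ≤ s) (hy : (supp y).card ≤ s) (hxy : ∀ i, x i * y i = 0) :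
    inner ℝ (A.apply x) (A.apply y) ≤ 2 * δ * ‖x‖ * ‖y‖ := by
  rcases eq_or_ne x 0 with rfl | hx0
  · simp [Dictionary.apply]
  rcases eq_or_ne y 0 with rfl | hy0
  · simp [Dictionary.apply]
  have px : 0 < ‖x‖ := norm_pos_iff.mpr hx0
  have py : 0 < ‖y‖ := norm_pos_iff.mpr hy0
  have hdis : ∀ i, (‖y‖ • x) i * (‖x‖ • y) i = 0 := by
    intro i
    simp only [PiLp.smul_apply, smul_eq_mul]
    linear_combination ‖y‖ * ‖x‖ * hxy i
  have hna : ‖‖y‖ • x‖ = ‖x‖ * ‖y‖ := by rw [norm_smul, norm_norm, mul_comm]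
  have hnb : ‖‖x‖ • y‖ = ‖x‖ * ‖y‖ := by rw [norm_smul, norm_norm]
  have hadd := (h (‖y‖ • x + ‖x‖ • y) (by
    rw [ncard_support]
    exact (supp_card_add_le _ _).trans ((add_le_add ((supp_card_smul_le ‖y‖ _).trans hx)
      ((supp_card_smul_le ‖x‖ _).trans hy)).trans (by omega)))).2
  have hsub := (h (‖y‖ • x - ‖x‖ • y) (by
    rw [ncard_support]
    exact (supp_card_sub_le _ _).trans ((add_le_add ((supp_card_smul_le ‖y‖ _).trans hx)
      ((supp_card_smul_le ‖x‖ _).trans hy)).trans (by omega)))).1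
  have nadd := norm_add_sq_of_disjoint hdis
  have nsub := norm_sub_sq_of_disjoint hdis
  rw [hna, hnb] at nadd nsub
  simp only [WithLp.ofLp_add, WithLp.ofLp_sub, WithLp.ofLp_smul, Dictionary.apply_add,
    Dictionary.apply_sub, Dictionary.apply_smul] at hadd hsub
  have sadd := pow_le_pow_left₀ (norm_nonneg _) hadd 2
  have ssub := pow_le_pow_left₀ (mul_nonneg (sub_nonneg.mpr hδ) (norm_nonneg _)) hsub 2
  rw [mul_pow, nadd, norm_add_sq_real] at sadd
  rw [mul_pow, nsub, norm_sub_sq_real] at ssub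
  rw [inner_smul_left, inner_smul_right] at sadd ssub
  simp only [conj_trivial] at sadd ssub
  have key : (‖x‖ * ‖y‖) * inner ℝ (A.apply x) (A.apply y) ≤
      (‖x‖ * ‖y‖) * (2 * δ * ‖x‖ * ‖y‖) := by nlinarith
  exact le_of_mul_le_mul_left key (mul_pos px py)

lemma Dictionary.IsRIP.nearIsometric {A : Dictionary n m} {k s : ℕ} {δ : ℝ} (h : A.IsRIP k δ)
    (hδ0 : 0 ≤ δ) (hδ : δ ≤ 1) (hs : 2 * s ≤ k) : A.NearIsometric s (3 * δ) := by
  constructor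
  · intro x hx
    obtain ⟨h1, h2⟩ := h x (by rw [ncard_support]; omega)
    have s1 := pow_le_pow_left₀ (mul_nonneg (sub_nonneg.mpr hδ) (norm_nonneg _)) h1 2
    have s2 := pow_le_pow_left₀ (norm_nonneg _) h2 2
    rw [mul_pow] at s1 s2
    have hp := sq_nonneg ‖x‖
    rw [abs_le]
    constructor <;> nlinarith [mul_nonneg hδ0 hp, mul_nonneg (mul_nonneg hδ0 hp) (sub_nonneg.mpr hδ)]
  · intro x y hx hy hxy
    have h1 := h.inner_le hδ hs x y hx hy hxy
    have h2 := h.inner_le hδ hs (-x) y (by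
      have := supp_card_smul_le (-1) (x : Fin m → ℝ)
      rw [neg_one_smul] at this
      exact this.trans hx) hy (by
      intro i
      simpa using hxy i)
    have h3 : A.apply (-x : EuclideanSpace ℝ (Fin m)) = -A.apply x := by
      have := A.apply_smul (-1) x
      rwa [neg_one_smul, neg_one_smul] at this
    rw [h3, inner_neg_left, norm_neg] at h2
    have := mul_nonneg (mul_nonneg hδ0 (norm_nonneg x)) (norm_nonneg y)
    rw [abs_le]
    constructor <;> linarith

lemma exists_split {s : ℕ} (x : EuclideanSpace ℝ (Fin m)) (hx : (supp x).card ≤ 2 * s) :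
    ∃ y z : EuclideanSpace ℝ (Fin m), x = y + z ∧ (supp y).card ≤ s ∧ (supp z).card ≤ s ∧
      (∀ i, y i * z i = 0) ∧ (∀ i, x i = 0 → y i = 0 ∧ z i = 0) := by
  classical
  obtain ⟨T, hT, hTc⟩ := Finset.exists_subset_card_eq (s := supp x) (n := min s (supp x).card)
    (min_le_right _ _)
  refine ⟨WithLp.toLp 2 fun i => if i ∈ T then x i else 0,
    WithLp.toLp 2 fun i => if i ∈ T then 0 else x i, ?_, ?_, ?_, ?_, ?_⟩
  · ext i
    by_cases hi : i ∈ T <;> simp [hi]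
  · have : supp (fun i => if i ∈ T then x i else 0) ⊆ T := by
      intro i hi
      by_contra hiT
      simp [hiT] at hi
    have := Finset.card_le_card this
    simp only at *
    omega
  · have : supp (fun i => if i ∈ T then 0 else x i) ⊆ supp x \ T := by
      intro i hi
      rw [mem_supp] at hi
      by_cases hiT : i ∈ T
      · simp [hiT] at hi
      · simpa [hiT] using hi
    have h1 := Finset.card_le_card this
    rw [Finset.card_sdiff_of_subset hT] at h1
    simp only at *
    omega
  · intro i
    by_cases hi : i ∈ T <;> simp [hi]
  · intro i hi
    simp [hi]

/-- Both vectors are cut into two `s`-sparse halves. The inner product becomes four terms, each at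
most `d` times the full norms; this is the source of the factor `4`. -/
lemma Dictionary.NearIsometric.double {A : Dictionary n m} {s : ℕ} {d : ℝ} (hd : 0 ≤ d)
    (h : A.NearIsometric s d) : A.NearIsometric (2 * s) (4 * d) := by
  constructor
  · intro x hx
    obtain ⟨y, z, rfl, hy, hz, hyz, -⟩ := exists_split x hx
    have h1 := h.abs_norm_sq_sub_le y hy
    have h2 := h.abs_norm_sq_sub_le z hz
    have h3 := h.abs_inner_le y z hy hz hyz
    rw [norm_add_sq_of_disjoint hyz, WithLp.ofLp_add, A.apply_add, norm_add_sq_real]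
    rw [abs_le] at *
    have h4 : d * ‖y‖ * ‖z‖ ≤ d * (‖y‖ ^ 2 + ‖z‖ ^ 2) := by
      rw [mul_assoc]
      exact mul_le_mul_of_nonneg_left (by nlinarith [sq_nonneg (‖y‖ - ‖z‖)]) hd
    have h5 : 0 ≤ d * (‖y‖ ^ 2 + ‖z‖ ^ 2) := by positivity
    constructor <;> linarith [h1.1, h1.2, h2.1, h2.2, h3.1, h3.2]
  · intro x y hx hy hxy
    obtain ⟨x₁, x₂, rfl, hx₁, hx₂, hx₁₂, hxs⟩ := exists_split x hx
    obtain ⟨y₁, y₂, rfl, hy₁, hy₂, hy₁₂, hys⟩ := exists_split y hy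
    have key : ∀ i, (x₁ i = 0 ∧ x₂ i = 0) ∨ (y₁ i = 0 ∧ y₂ i = 0) := fun i =>
      (mul_eq_zero.mp (hxy i)).imp (hxs i) (hys i)
    have h11 := h.abs_inner_le x₁ y₁ hx₁ hy₁ fun i => by rcases key i with h | h <;> simp [h.1]
    have h12 := h.abs_inner_le x₁ y₂ hx₁ hy₂ fun i => by
      rcases key i with h | h <;> simp [h.1, h.2]
    have h21 := h.abs_inner_le x₂ y₁ hx₂ hy₁ fun i => by
      rcases key i with h | h <;> simp [h.1, h.2]
    have h22 := h.abs_inner_le x₂ y₂ hx₂ hy₂ fun i => by rcases key i with h | h <;> simp [h.2]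
    have nx := norm_add_sq_of_disjoint hx₁₂
    have ny := norm_add_sq_of_disjoint hy₁₂
    have a1 : ‖x₁‖ ≤ ‖x₁ + x₂‖ := by
      refine le_of_sq_le_sq ?_ (norm_nonneg _)
      nlinarith [sq_nonneg ‖x₂‖]
    have a2 : ‖x₂‖ ≤ ‖x₁ + x₂‖ := by
      refine le_of_sq_le_sq ?_ (norm_nonneg _)
      nlinarith [sq_nonneg ‖x₁‖]
    have b1 : ‖y₁‖ ≤ ‖y₁ + y₂‖ := by
      refine le_of_sq_le_sq ?_ (norm_nonneg _)
      nlinarith [sq_nonneg ‖y₂‖]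
    have b2 : ‖y₂‖ ≤ ‖y₁ + y₂‖ := by
      refine le_of_sq_le_sq ?_ (norm_nonneg _)
      nlinarith [sq_nonneg ‖y₁‖]
    have bd : ∀ {p q : ℝ}, 0 ≤ p → 0 ≤ q → p ≤ ‖x₁ + x₂‖ → q ≤ ‖y₁ + y₂‖ →
        d * p * q ≤ d * ‖x₁ + x₂‖ * ‖y₁ + y₂‖ := by
      intro p q _ _ hp hq
      gcongr
    have c11 := bd (norm_nonneg _) (norm_nonneg _) a1 b1
    have c12 := bd (norm_nonneg _) (norm_nonneg _) a1 b2
    have c21 := bd (norm_nonneg _) (norm_nonneg _) a2 b1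
    have c22 := bd (norm_nonneg _) (norm_nonneg _) a2 b2
    rw [WithLp.ofLp_add, WithLp.ofLp_add, A.apply_add, A.apply_add, inner_add_left,
      inner_add_right, inner_add_right]
    rw [abs_le] at *
    constructor <;> linarith [h11.1, h11.2, h12.1, h12.2, h21.1, h21.2, h22.1, h22.2]

lemma Dictionary.NearIsometric.mono {A : Dictionary n m} {s s' : ℕ} {d : ℝ}
    (h : A.NearIsometric s d) (hs : s' ≤ s) : A.NearIsometric s' d :=
  ⟨fun x hx => h.1 x (hx.trans hs), fun x y hx hy => h.2 x y (hx.trans hs) (hy.trans hs)⟩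

/-- The restricted isometry property at order `k` implies one at order `4 k`. -/
lemma Dictionary.IsRIP.nearIsometric_four_mul {A : Dictionary n m} {k : ℕ} {δ : ℝ}
    (h : A.IsRIP k δ) (hk : 2 ≤ k) (hδ0 : 0 ≤ δ) (hδ : δ ≤ 1) :
    A.NearIsometric (4 * k) (768 * δ) := by
  -- Four doublings starting from `⌊k/2⌋`: `16 * ⌊k/2⌋ ≥ 4k` because `k ≥ 2`, and `3 * 4⁴ = 768`.
  have h1 := (h.nearIsometric (s := k / 2) hδ0 hδ (by omega)).double (by positivity)
  have h2 := ((h1.double (by positivity)).double (by positivity)).double (by positivity)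
  have h3 := h2.mono (s' := 4 * k) (by omega)
  convert h3 using 1
  ring

/-! ### Codes under sign changes -/

/-- Change the sign of the coordinates in `F`. -/
noncomputable def flip (F : Finset (Fin m)) (x : Fin m → ℝ) : Fin m → ℝ :=
  fun j => if j ∈ F then -x j else x j

/-- `k`-sparse vectors whose nonzero entries have absolute value in `[1, C]`. -/
def IsCode (k : ℕ) (C : ℝ) (c : Fin m → ℝ) : Prop :=
  (supp c).card ≤ k ∧ ∀ l, c l = 0 ∨ (1 ≤ |c l| ∧ |c l| ≤ C)

/-- `y` is within `e` of the image under `B` of a code. -/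
def Explains (B : Dictionary n m) (k : ℕ) (C e : ℝ) (y : EuclideanSpace ℝ (Fin n)) : Prop :=
  ∃ c : Fin m → ℝ, IsCode k C c ∧ ‖y - B.apply c‖ ≤ e

/-- The map of a dictionary does not shrink `s`-sparse vectors by more than a factor `2`. -/
def Dictionary.BoundedBelow (B : Dictionary n m) (s : ℕ) : Prop :=
  ∀ z : EuclideanSpace ℝ (Fin m), (supp z).card ≤ s → ‖z‖ ≤ 2 * ‖B.apply z‖

lemma Dictionary.BoundedBelow.abs_coord_le {B : Dictionary n m} {s : ℕ} (hB : B.BoundedBelow s)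
    (z : Fin m → ℝ) (hz : (supp z).card ≤ s) (l : Fin m) : |z l| ≤ 2 * ‖B.apply z‖ :=
  (PiLp.norm_apply_le (WithLp.toLp 2 z) l).trans (hB (WithLp.toLp 2 z) hz)

lemma Dictionary.NearIsometric.boundedBelow {B : Dictionary n m} {s : ℕ} {d : ℝ}
    (hB : B.NearIsometric s d) (hd : d ≤ 1 / 2) : B.BoundedBelow s := by
  intro z hz
  have h := (abs_le.mp (hB.abs_norm_sq_sub_le z hz)).1
  refine le_of_sq_le_sq ?_ (by positivity)
  nlinarith [sq_nonneg ‖z‖, sq_nonneg ‖B.apply z‖]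

lemma coeff_flip_insert {S F : Finset (Fin m)} {s : Fin m} (hs : s ∈ S) (hF : s ∉ F)
    (x : Fin m → ℝ) :
    coeff S (flip (insert s F) x) = coeff S (flip F x) - (2 * x s) • Pi.single s 1 := by
  classical
  ext j
  rcases eq_or_ne j s with rfl | hj
  · simp [coeff, flip, hs, hF]; ring
  · simp [coeff, flip, hj]

lemma coeff_flip_self (S : Finset (Fin m)) (x : Fin m → ℝ) :
    coeff S (flip S x) = -coeff S (flip ∅ x) := by
  ext j
  by_cases hj : j ∈ S <;> simp [coeff, flip, hj]

lemma apply_coeff_flip_insert (A : Dictionary n m) {S F : Finset (Fin m)} {s : Fin m}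
    (hs : s ∈ S) (hF : s ∉ F) (x : Fin m → ℝ) :
    A.apply (coeff S (flip (insert s F) x)) =
      A.apply (coeff S (flip F x)) - (2 * x s) • A s := by
  rw [coeff_flip_insert hs hF, A.apply_sub, A.apply_smul, A.apply_single, one_smul]

lemma apply_coeff_flip_self (A : Dictionary n m) (S : Finset (Fin m)) (x : Fin m → ℝ) :
    A.apply (coeff S (flip S x)) = -A.apply (coeff S (flip ∅ x)) := by
  rw [coeff_flip_self, ← neg_one_smul ℝ (coeff _ _), A.apply_smul, neg_one_smul]

/-- The vector `c' - c + a • w` is `4k`-sparse and its image under `B` is a combination of the three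
errors; a map bounded below on `4k`-sparse vectors then controls each coordinate. So a change of the
sample by `a • z` moves the code by about `a • w`. -/
lemma code_step {B : Dictionary n m} {k : ℕ} (hB : B.BoundedBelow (4 * k)) {e a : ℝ}
    {c c' w : Fin m → ℝ} {y y' z : EuclideanSpace ℝ (Fin n)} (hc : (supp c).card ≤ k)
    (hc' : (supp c').card ≤ k) (hw : (supp w).card ≤ 2 * k) (hy : ‖y - B.apply c‖ ≤ e)
    (hy' : ‖y' - B.apply c'‖ ≤ e) (hz : ‖z - B.apply w‖ ≤ e) (hyy : y' = y - a • z) (l : Fin m) :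
    |c' l - c l + a * w l| ≤ 2 * (2 + |a|) * e := by
  have h1 := hB.abs_coord_le (c' - c + a • w) (by
    have h1 := supp_card_add_le (c' - c) (a • w)
    have h2 := supp_card_sub_le c' c
    have h3 := supp_card_smul_le a w
    omega) l
  have h2 : B.apply (c' - c + a • w) =
      (y - B.apply c) - (y' - B.apply c') - a • (z - B.apply w) := by
    rw [B.apply_add, B.apply_sub, B.apply_smul, hyy, smul_sub]
    abel
  have h3 : ‖B.apply (c' - c + a • w)‖ ≤ e + e + |a| * e := by
    rw [h2]
    refine (norm_sub_le _ _).trans (add_le_add ((norm_sub_le _ _).trans (add_le_add hy hy')) ?_)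
    rw [norm_smul, Real.norm_eq_abs]
    gcongr
  simp only [Pi.add_apply, Pi.sub_apply, Pi.smul_apply, smul_eq_mul] at h1
  linarith

lemma code_neg {B : Dictionary n m} {k : ℕ} (hB : B.BoundedBelow (4 * k)) {e : ℝ}
    {c c' : Fin m → ℝ} {y : EuclideanSpace ℝ (Fin n)} (hc : (supp c).card ≤ k)
    (hc' : (supp c').card ≤ k) (hy : ‖y - B.apply c‖ ≤ e) (hy' : ‖-y - B.apply c'‖ ≤ e)
    (l : Fin m) : |c l + c' l| ≤ 4 * e := by
  have h1 := hB.abs_coord_le (c + c') (by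
    have h1 := supp_card_add_le c c'
    omega) l
  have h3 : ‖B.apply (c + c')‖ ≤ e + e := by
    have : B.apply (c + c') = -((y - B.apply c) + (-y - B.apply c')) := by
      rw [B.apply_add]; abel
    rw [this, norm_neg]
    exact (norm_add_le _ _).trans (add_le_add hy hy')
  simp only [Pi.add_apply] at h1
  linarith

/-- Listing `E` element by element gives a path of sign patterns from no flip to the flip of all of
`E`. -/
lemma exists_chain (E : Finset (Fin m)) : ∃ F : ℕ → Finset (Fin m), F 0 = ∅ ∧ F E.card = E ∧
    ∀ p < E.card, ∃ s ∈ E, s ∉ F p ∧ F (p + 1) = insert s (F p) := by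
  classical
  induction E using Finset.induction_on with
  | empty => exact ⟨fun _ => ∅, by simp⟩
  | insert a E ha ih =>
    obtain ⟨F, h0, hE, hF⟩ := ih
    refine ⟨fun p => if p ≤ E.card then F p else insert a E, by simp [h0], ?_, ?_⟩
    · rw [Finset.card_insert_of_notMem ha]
      simp
    · intro p hp
      rw [Finset.card_insert_of_notMem ha] at hp
      rcases (Nat.lt_succ_iff.mp hp).lt_or_eq with hlt | rfl
      · obtain ⟨s, hs, hsF, hFs⟩ := hF p hlt
        exact ⟨s, Finset.mem_insert_of_mem hs, by simpa [hlt.le] using hsF, by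
          simp [hlt.le, Nat.succ_le_iff.mpr hlt, hFs]⟩
      · exact ⟨a, Finset.mem_insert_self _ _, by simpa [hE] using ha, by simp [hE]⟩

/-- A coordinate of the codes along a chain of sign changes stays zero, or keeps its sign,
as long as it changes by less than `1` in every step. -/
lemma sign_class_const {v : ℕ → ℝ} {b : ℕ} (hv : ∀ p ≤ b, v p = 0 ∨ 1 ≤ |v p|)
    (hstep : ∀ p < b, |v (p + 1) - v p| < 1) :
    (v 0 = 0 ∧ v b = 0) ∨ (1 ≤ v 0 ∧ 1 ≤ v b) ∨ (v 0 ≤ -1 ∧ v b ≤ -1) := by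
  induction b with
  | zero =>
    rcases hv 0 le_rfl with h | h
    · exact Or.inl ⟨h, h⟩
    · rcases le_abs.mp h with h | h
      · exact Or.inr (Or.inl ⟨h, h⟩)
      · exact Or.inr (Or.inr ⟨by linarith, by linarith⟩)
  | succ b ih =>
    have h1 := abs_lt.mp (hstep b (Nat.lt_succ_self b))
    have h2 := hv (b + 1) le_rfl
    rw [le_abs] at h2
    rcases ih (fun p hp => hv p (by omega)) (fun p hp => hstep p (by omega)) with
      ⟨h3, h4⟩ | ⟨h3, h4⟩ | ⟨h3, h4⟩
    · refine Or.inl ⟨h3, ?_⟩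
      rcases h2 with h2 | h2 | h2
      · exact h2
      · linarith
      · linarith
    · refine Or.inr (Or.inl ⟨h3, ?_⟩)
      rcases h2 with h2 | h2 | h2 <;> linarith
    · refine Or.inr (Or.inr ⟨h3, ?_⟩)
      rcases h2 with h2 | h2 | h2 <;> linarith

/-- Let `w j` be sparse representations of the columns of `A` in the dictionary `B`. If the
samples with support `S` that arise from each other by the sign changes of a chain through
`S.erase i` and `S` all have codes in `B`, then `w i l` is negligible or almost of size `1`. -/
lemma entry_dichotomy {A B : Dictionary n m} {k : ℕ} {C e τ : ℝ} (hB : B.BoundedBelow (4 * k))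
    (he : 0 ≤ e) {w : Fin m → Fin m → ℝ} (hw : ∀ j, (supp (w j)).card ≤ 2 * k)
    (hwA : ∀ j, ‖A j - B.apply (w j)‖ ≤ e) {i l : Fin m} {S : Finset (Fin m)} (hi : i ∈ S)
    (hτ : ∀ j ∈ S, j ≠ i → |w j l| ≤ τ) (hτ1 : 2 * C * τ + 4 * (1 + C) * e < 1) {x : Fin m → ℝ}
    (hx : ∀ j, |x j| ≤ C) {F : ℕ → Finset (Fin m)} (hF0 : F 0 = ∅)
    (hFb : F (S.erase i).card = S.erase i)
    (hF : ∀ p < (S.erase i).card, ∃ s ∈ S.erase i, s ∉ F p ∧ F (p + 1) = insert s (F p))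
    (hcode : ∀ p ≤ (S.erase i).card, Explains B k C e (A.apply (coeff S (flip (F p) x))))
    (hlast : Explains B k C e (A.apply (coeff S (flip S x)))) :
    |x i| * |w i l| ≤ (4 + 2 * C) * e ∨ 1 - (4 + 2 * C) * e ≤ |x i| * |w i l| := by
  classical
  set b := (S.erase i).card with hb
  have hex : ∀ p, ∃ c : Fin m → ℝ, p ≤ b →
      IsCode k C c ∧ ‖A.apply (coeff S (flip (F p) x)) - B.apply c‖ ≤ e := by
    intro p
    by_cases hp : p ≤ b
    · obtain ⟨c, hc⟩ := hcode p hp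
      exact ⟨c, fun _ => hc⟩
    · exact ⟨0, fun h => absurd h hp⟩
  choose c hc using hex
  obtain ⟨c', hc', hyc'⟩ := hlast
  have h2x : ∀ j, |2 * x j| ≤ 2 * C := fun j => by
    rw [abs_mul, abs_two]; linarith [hx j]
  have hbound : ∀ j, 2 * (2 + |2 * x j|) * e ≤ 4 * (1 + C) * e := fun j => by
    refine mul_le_mul_of_nonneg_right ?_ he
    linarith [h2x j]
  -- Flipping `s` moves the entry at `l` by `2 * x s * w s l` up to an error of `4(1+C)e`, in total
  -- less than `1`.
  have hclass := sign_class_const (v := fun p => c p l) (b := b)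
    (fun p hp => ((hc p hp).1.2 l).imp id And.left) (fun p hp => by
      obtain ⟨s, hs, hsF, hFs⟩ := hF p hp
      have h := code_step hB (hc p hp.le).1.1 (hc (p + 1) hp).1.1 (hw s) (hc p hp.le).2
        (hc (p + 1) hp).2 (hwA s)
        (by rw [hFs]; exact apply_coeff_flip_insert A (Finset.mem_of_mem_erase hs) hsF x) l
      have h1 := hτ s (Finset.mem_of_mem_erase hs) (Finset.ne_of_mem_erase hs)
      have h2 : |2 * x s * w s l| ≤ 2 * C * τ := by
        rw [abs_mul]
        exact mul_le_mul (h2x s) h1 (abs_nonneg _) ((abs_nonneg _).trans (h2x s))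
      have h3 := hbound s
      rw [abs_lt]
      rw [abs_le] at h h2
      constructor <;> linarith [h.1, h.2, h2.1, h2.2])
  -- The last step flips `i`; all of `S` is then flipped, so the sample is the negative of the
  -- initial one.
  have hstep := code_step hB (hc b le_rfl).1.1 hc'.1 (hw i) (hc b le_rfl).2 hyc' (hwA i) (by
    rw [hFb]
    have := apply_coeff_flip_insert A hi (Finset.notMem_erase i S) x
    rwa [Finset.insert_erase hi] at this) l
  have hneg := code_neg hB (hc 0 (Nat.zero_le _)).1.1 hc'.1 (hc 0 (Nat.zero_le _)).2 (by
    rw [hF0, ← apply_coeff_flip_self]; exact hyc') l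
  have h3 := hbound i
  have hw2 : |x i| * |w i l| = |2 * x i * w i l| / 2 := by
    rw [mul_assoc, abs_mul, abs_two, abs_mul]; ring
  rw [hw2]
  rw [abs_le] at hstep hneg
  -- Since `2 * x i * w i l ≈ c b l - c' l` and `c' l ≈ -c 0 l`, it is close to `c 0 l + c b l`,
  -- whose terms are both zero, both at least `1`, or both at most `-1`. The errors add up to
  -- `4(1+C)e + 4e = 2(4+2C)e`.
  rcases hclass with ⟨h0, hb0⟩ | ⟨h0, hb0⟩ | ⟨h0, hb0⟩
  · left
    have : |2 * x i * w i l| ≤ 2 * ((4 + 2 * C) * e) := by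
      rw [abs_le]
      constructor <;> linarith [hstep.1, hstep.2, hneg.1, hneg.2]
    linarith
  · right
    have : 2 - 2 * ((4 + 2 * C) * e) ≤ |2 * x i * w i l| := by
      rw [le_abs]
      left
      linarith [hstep.1, hstep.2, hneg.1, hneg.2]
    linarith
  · right
    have : 2 - 2 * ((4 + 2 * C) * e) ≤ |2 * x i * w i l| := by
      rw [le_abs]
      right
      linarith [hstep.1, hstep.2, hneg.1, hneg.2]
    linarith

/-! ### Matching columns of the two dictionaries -/

/-- Bessel's inequality for almost orthonormal vectors. With `a j = ⟪z, A j⟫` and `v = ∑ a j • A j`,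
the sum `s` of squares equals `⟪z, v⟫ ≤ ‖v‖`, while `‖v‖² ≤ s + d (∑ |a j|)² ≤ s (1 + d |J|)`; then
`s` is cancelled from `s² ≤ ‖v‖²`. -/
lemma sum_inner_sq_le {A : Dictionary n m} {d : ℝ} (hd : 0 ≤ d) (hA : ∀ i, ‖A i‖ = 1)
    (hAd : ∀ i j, i ≠ j → |inner ℝ (A i) (A j)| ≤ d) {z : EuclideanSpace ℝ (Fin n)}
    (hz : ‖z‖ = 1) (J : Finset (Fin m)) :
    ∑ j ∈ J, inner ℝ z (A j) ^ 2 ≤ 1 + d * J.card := by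
  classical
  set a : Fin m → ℝ := fun j => inner ℝ z (A j) with ha
  set s := ∑ j ∈ J, a j ^ 2 with hs
  have hs0 : 0 ≤ s := Finset.sum_nonneg fun _ _ => sq_nonneg _
  set v := ∑ j ∈ J, a j • A j with hv
  have h1 : s = inner ℝ z v := by
    simp only [hv, inner_sum, inner_smul_right, hs, sq]
    rfl
  have h2 : s ≤ ‖v‖ := by
    rw [h1]
    simpa [hz] using real_inner_le_norm z v
  have h3 : ‖v‖ ^ 2 ≤ s + d * (∑ j ∈ J, |a j|) ^ 2 := by
    rw [← real_inner_self_eq_norm_sq, hv, sum_inner, sq (∑ j ∈ J, |a j|), Finset.sum_mul_sum,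
      Finset.mul_sum, hs, ← Finset.sum_add_distrib]
    refine Finset.sum_le_sum fun i hi => ?_
    rw [inner_sum, Finset.mul_sum, ← Finset.add_sum_erase J _ hi, ← Finset.add_sum_erase J _ hi]
    have e1 : inner ℝ (a i • A i) (a i • A i) = a i ^ 2 := by
      rw [real_inner_self_eq_norm_sq, norm_smul, hA i, mul_one, Real.norm_eq_abs, sq_abs]
    have e2 : ∀ j ∈ J.erase i, inner ℝ (a i • A i) (a j • A j) ≤ d * (|a i| * |a j|) := by
      intro j hj
      rw [inner_smul_left, inner_smul_right, conj_trivial, ← mul_assoc]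
      refine (le_abs_self _).trans ?_
      rw [abs_mul, abs_mul, mul_comm]
      exact mul_le_mul_of_nonneg_right (hAd i j (Finset.ne_of_mem_erase hj).symm) (by positivity)
    have e3 : 0 ≤ d * (|a i| * |a i|) := by positivity
    have e4 := Finset.sum_le_sum e2
    linarith
  have h4 : (∑ j ∈ J, |a j|) ^ 2 ≤ J.card * s := by
    have := sq_sum_le_card_mul_sum_sq (s := J) (f := fun j => |a j|)
    simpa only [sq_abs] using this
  have h5 : s * s ≤ s * (1 + d * J.card) := by
    have := mul_le_mul_of_nonneg_left h4 hd
    have h6 := pow_le_pow_left₀ hs0 h2 2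
    nlinarith
  rcases hs0.eq_or_lt with h | h
  · rw [← h]; positivity
  · exact le_of_mul_le_mul_left h5 h

lemma supp_single_card_le (i : Fin m) (a : ℝ) : (supp (Pi.single i a : Fin m → ℝ)).card ≤ 1 := by
  classical
  refine (Finset.card_le_card (t := {i}) fun j hj => ?_).trans (by simp)
  by_contra h
  simp only [Finset.mem_singleton] at h
  simp [h] at hj

lemma Dictionary.NearIsometric.abs_inner_column_le {A : Dictionary n m} {s : ℕ} {d : ℝ}
    (hA : A.NearIsometric s d) (hs : 1 ≤ s) {i : Fin m} {y : Fin m → ℝ} (hy : (supp y).card ≤ s)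
    (hyi : y i = 0) :
    |inner ℝ (A i) (A.apply y)| ≤ d * ‖(WithLp.toLp 2 y : EuclideanSpace ℝ (Fin m))‖ := by
  classical
  have := hA.abs_inner_le (WithLp.toLp 2 (Pi.single i 1)) (WithLp.toLp 2 y)
    ((supp_single_card_le i 1).trans hs) hy (fun j => by
      rcases eq_or_ne j i with rfl | hj
      · simp [hyi]
      · simp [hj])
  simpa [A.apply_single] using this

lemma Dictionary.NearIsometric.abs_inner_columns_le {A : Dictionary n m} {s : ℕ} {d : ℝ}
    (hA : A.NearIsometric s d) (hs : 1 ≤ s) {i j : Fin m} (hij : i ≠ j) :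
    |inner ℝ (A i) (A j)| ≤ d := by
  classical
  have := hA.abs_inner_column_le hs (i := i) (y := Pi.single j 1)
    ((supp_single_card_le j 1).trans hs) (by simp [hij])
  simpa [A.apply_single] using this

/-- If the columns of `A` are nearly sparse combinations of the columns of `B`, then a fixed
column of `B` has a large coefficient in few of them only. -/
lemma card_large_entries_le {A B : Dictionary n m} {k : ℕ} {d e τ : ℝ} (hk : 1 ≤ k)
    (hd : 0 ≤ d) (hd1 : d ≤ 1 / 2) (he1 : e ≤ 1) (hdτ : 8 * d + e ≤ τ / 2) (hτ : 0 ≤ τ)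
    (hA1 : ∀ i, ‖A i‖ = 1) (hB1 : ∀ i, ‖B i‖ = 1)
    (hA : A.NearIsometric (4 * k) d) (hB : B.NearIsometric (4 * k) d)
    {w : Fin m → Fin m → ℝ} (hw : ∀ j, (supp (w j)).card ≤ 2 * k)
    (hwA : ∀ j, ‖A j - B.apply (w j)‖ ≤ e) (l : Fin m) {J : Finset (Fin m)}
    (hJ : ∀ j ∈ J, τ ≤ |w j l|) : J.card * (τ ^ 2 / 4 - d) ≤ 1 := by
  classical
  have hbb := hB.boundedBelow hd1
  -- The entry `w j l` is nearly the inner product of `B l` and `A j`: the other entries of `w j`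
  -- contribute at most `8d` by near orthogonality and the representation error at most `e`,
  -- together at most `τ/2`.
  have key : ∀ j ∈ J, τ ^ 2 / 4 ≤ inner ℝ (B l) (A j) ^ 2 := by
    intro j hj
    have hn : ‖B.apply (w j)‖ ≤ 1 + e := by
      have := norm_sub_norm_le (B.apply (w j)) (A j)
      rw [norm_sub_rev, hA1 j] at this
      linarith [hwA j]
    have hwn : ‖(WithLp.toLp 2 (w j) : EuclideanSpace ℝ (Fin m))‖ ≤ 4 := by
      have := hbb (WithLp.toLp 2 (w j)) ((hw j).trans (by omega))
      simp only at this
      linarith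
    have hwl : |w j l| ≤ 4 :=
      (PiLp.norm_apply_le (WithLp.toLp 2 (w j) : EuclideanSpace ℝ (Fin m)) l).trans hwn
    have hy := hB.abs_inner_column_le (i := l) (y := w j - Pi.single l (w j l)) (by omega) (by
      have := supp_card_sub_le (w j) (Pi.single l (w j l))
      have := supp_single_card_le l (w j l)
      have := hw j
      omega) (by simp)
    have hyn : ‖(WithLp.toLp 2 (w j - Pi.single l (w j l)) : EuclideanSpace ℝ (Fin m))‖ ≤ 8 := by
      rw [WithLp.toLp_sub]
      refine (norm_sub_le _ _).trans ?_
      have : ‖(WithLp.toLp 2 (Pi.single l (w j l)) : EuclideanSpace ℝ (Fin m))‖ = |w j l| := by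
        simp
      linarith
    have hy8 : d * ‖(WithLp.toLp 2 (w j - Pi.single l (w j l)) : EuclideanSpace ℝ (Fin m))‖ ≤
      d * 8 := mul_le_mul_of_nonneg_left hyn hd
    have hdec : inner ℝ (B l) (A j) = w j l + inner ℝ (B l) (B.apply (w j - Pi.single l (w j l)))
        + inner ℝ (B l) (A j - B.apply (w j)) := by
      rw [B.apply_sub, B.apply_single, inner_sub_right, inner_sub_right, inner_smul_right,
        real_inner_self_eq_norm_sq, hB1 l]
      ring
    have hin : |inner ℝ (B l) (A j - B.apply (w j))| ≤ e := by
      refine (abs_real_inner_le_norm _ _).trans ?_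
      rw [hB1 l, one_mul]
      exact hwA j
    have hlow : τ / 2 ≤ |inner ℝ (B l) (A j)| := by
      rw [hdec]
      have h1 := abs_sub_abs_le_abs_sub (w j l)
        (-(inner ℝ (B l) (B.apply (w j - Pi.single l (w j l)))
        + inner ℝ (B l) (A j - B.apply (w j))))
      rw [abs_neg, sub_neg_eq_add, ← add_assoc] at h1
      have h2 := abs_add_le (inner ℝ (B l) (B.apply (w j - Pi.single l (w j l))))
        (inner ℝ (B l) (A j - B.apply (w j)))
      have h3 := hJ j hj
      linarith
    have h2 := pow_le_pow_left₀ (by linarith) hlow 2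
    rw [sq_abs] at h2
    linarith
  have h1 := Finset.card_nsmul_le_sum J _ _ key
  have h2 := sum_inner_sq_le hd hA1 (fun i j hij => hA.abs_inner_columns_le (by omega) hij)
    (hB1 l) J
  rw [nsmul_eq_mul] at h1
  linarith

/-- A unit vector whose sparse representation has only negligible entries and entries close
to `1` or larger is close to a single column, up to sign. -/
lemma exists_column_near {B : Dictionary n m} {k : ℕ} {d e ε ρ : ℝ} (hd1 : d ≤ 1 / 128)
    (he0 : 0 ≤ e) (he : e ≤ 1 / 100) (hε : 0 ≤ ε) (hρ : e + 2 * k * ε ≤ ρ) (hρ1 : ρ < 1)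
    (hB1 : ∀ i, ‖B i‖ = 1) (hB : B.NearIsometric (4 * k) d) {a : EuclideanSpace ℝ (Fin n)}
    (ha : ‖a‖ = 1) {v : Fin m → ℝ} (hv : (supp v).card ≤ 2 * k) (hva : ‖a - B.apply v‖ ≤ e)
    (hdich : ∀ l, |v l| ≤ ε ∨ 9 / 10 ≤ |v l|) :
    ∃ (l : Fin m) (b : ℝ), (b = 1 ∨ b = -1) ∧ ‖B l - b • a‖ ≤ 2 * ρ := by
  classical
  have hn : ‖B.apply v‖ ≤ 1 + e := by
    have := norm_sub_norm_le (B.apply v) a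
    rw [norm_sub_rev, ha] at this
    linarith
  have hvn : ‖(WithLp.toLp 2 v : EuclideanSpace ℝ (Fin m))‖ ^ 2 ≤ 105 / 100 := by
    have h1 := (abs_le.mp (hB.abs_norm_sq_sub_le (WithLp.toLp 2 v) (hv.trans (by omega)))).1
    have h2 := pow_le_pow_left₀ (norm_nonneg _) hn 2
    simp only at h1
    nlinarith [sq_nonneg ‖(WithLp.toLp 2 v : EuclideanSpace ℝ (Fin m))‖]
  -- Two large entries would give `‖v‖² ≥ 2 * 0.81`, above the bound `1.05`.
  have huniq : ∀ l l', l ≠ l' → 9 / 10 ≤ |v l| → |v l'| ≤ ε := by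
    intro l l' hll hl
    refine (hdich l').resolve_right fun hl' => ?_
    rw [EuclideanSpace.norm_sq_eq] at hvn
    have h1 : ∑ i ∈ {l, l'}, ‖v i‖ ^ 2 ≤ ∑ i, ‖v i‖ ^ 2 :=
      Finset.sum_le_sum_of_subset_of_nonneg (Finset.subset_univ _) fun _ _ _ => sq_nonneg _
    rw [Finset.sum_pair hll, Real.norm_eq_abs, Real.norm_eq_abs] at h1
    have h2 := pow_le_pow_left₀ (by norm_num) hl 2
    have h3 := pow_le_pow_left₀ (by norm_num) hl' 2
    simp only at hvn
    linarith
  have hsmall : ∀ J : Finset (Fin m), (∀ j ∈ J, |v j| ≤ ε) → ‖∑ j ∈ J, v j • B j‖ ≤ 2 * k * ε := by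
    intro J hJ
    have h1 : ∑ j ∈ J, v j • B j = ∑ j ∈ J ∩ supp v, v j • B j := by
      symm
      refine Finset.sum_subset Finset.inter_subset_left fun j hj hjv => ?_
      have : v j = 0 := by
        by_contra h0
        exact hjv (Finset.mem_inter.mpr ⟨hj, mem_supp.mpr h0⟩)
      rw [this, zero_smul]
    rw [h1]
    refine (norm_sum_le_of_le (J ∩ supp v) (n := fun _ => ε) fun j hj => ?_).trans ?_
    · rw [norm_smul, hB1, mul_one]
      exact hJ j (Finset.mem_inter.mp hj).1
    · rw [Finset.sum_const, nsmul_eq_mul]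
      refine mul_le_mul_of_nonneg_right ?_ hε
      have : (J ∩ supp v).card ≤ 2 * k := (Finset.card_le_card Finset.inter_subset_right).trans hv
      exact_mod_cast this
  -- If all entries were negligible, then `‖a‖ ≤ e + 2kε < 1`.
  have hex : ∃ l, 9 / 10 ≤ |v l| := by
    by_contra! hno
    have h1 := hsmall Finset.univ fun j _ => (hdich j).resolve_right (not_le.mpr (hno j))
    have h2 : B.apply v = ∑ j, v j • B j := rfl
    rw [← h2] at h1
    have h3 := norm_sub_norm_le a (B.apply v)
    rw [ha] at h3
    linarith
  obtain ⟨l, hl⟩ := hex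
  have h1 := hsmall (Finset.univ.erase l) fun j hj =>
    huniq l j (Finset.ne_of_mem_erase hj).symm hl
  have h2 : B.apply v = v l • B l + ∑ j ∈ Finset.univ.erase l, v j • B j :=
    (Finset.add_sum_erase _ (fun j => v j • B j) (Finset.mem_univ l)).symm
  have h3 : ‖a - v l • B l‖ ≤ ρ := by
    have : a - v l • B l = (a - B.apply v) + ∑ j ∈ Finset.univ.erase l, v j • B j := by
      rw [h2]; abel
    rw [this]
    refine (norm_add_le _ _).trans ?_
    linarith
  have h4 : |(|v l|) - 1| ≤ ρ := by
    have := abs_norm_sub_norm_le (v l • B l) a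
    rw [norm_smul, hB1, mul_one, ha, norm_sub_rev, Real.norm_eq_abs] at this
    linarith
  rcases le_abs.mp hl with hl | hl
  · refine ⟨l, 1, Or.inl rfl, ?_⟩
    have : B l - (1 : ℝ) • a = (1 - v l) • B l - (a - v l • B l) := by module
    rw [this]
    refine (norm_sub_le _ _).trans ?_
    rw [norm_smul, hB1, mul_one, Real.norm_eq_abs, abs_sub_comm]
    rw [abs_of_nonneg (by linarith : (0 : ℝ) ≤ v l)] at h4
    linarith
  · refine ⟨l, -1, Or.inr rfl, ?_⟩
    have : B l - (-1 : ℝ) • a = (1 + v l) • B l + (a - v l • B l) := by module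
    rw [this]
    refine (norm_add_le _ _).trans ?_
    rw [norm_smul, hB1, mul_one, Real.norm_eq_abs]
    rw [abs_of_nonpos (by linarith : v l ≤ 0), ← abs_neg] at h4
    have : -(-v l - 1) = 1 + v l := by ring
    rw [this] at h4
    linarith

/-! ### Fitting many sign patterns forces recovery -/

/-- Support `S` and dictionary `B` are compatible at `i`: for any `k + 1` patterns of sign changes
there are admissible values, close to `1` at `i`, such that all the resulting samples with
support `S` have codes in `B`. -/
def FlipCompatible (A B : Dictionary n m) (k : ℕ) (C e η : ℝ) (i : Fin m)
    (S : Finset (Fin m)) : Prop :=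
  ∀ G : Finset (Finset (Fin m)), G.card ≤ k + 1 →
    ∃ x : Fin m → ℝ, (∀ j, 1 ≤ |x j| ∧ |x j| ≤ C) ∧ |x i| ≤ 1 + η ∧
      ∀ F ∈ G, Explains B k C e (A.apply (coeff S (flip F x)))

/-- The patterns `∅` and `{i}` give samples that differ by `2 * x i • A i`, so `w` is the difference
of their codes divided by `2 * x i`. As `|x i| ≥ 1`, the error `2e` is reduced to at most `e`. -/
lemma FlipCompatible.exists_representation {A B : Dictionary n m} {k : ℕ} {C e η : ℝ}
    {i : Fin m} {S : Finset (Fin m)} (hk : 1 ≤ k) (he : 0 ≤ e) (hi : i ∈ S)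
    (h : FlipCompatible A B k C e η i S) :
    ∃ w : Fin m → ℝ, (supp w).card ≤ 2 * k ∧ ‖A i - B.apply w‖ ≤ e := by
  classical
  obtain ⟨x, hx, -, hF⟩ := h {∅, {i}} ((Finset.card_le_two).trans (by omega))
  obtain ⟨c, hc, hyc⟩ := hF ∅ (by simp)
  obtain ⟨c', hc', hyc'⟩ := hF {i} (by simp)
  have hx1 := (hx i).1
  have hx0 : x i ≠ 0 := by
    intro h0
    rw [h0, abs_zero] at hx1
    linarith
  have hy := apply_coeff_flip_insert A hi (Finset.notMem_empty i) x
  rw [insert_empty_eq] at hy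
  refine ⟨(2 * x i)⁻¹ • (c - c'), ?_, ?_⟩
  · have h1 := supp_card_smul_le (2 * x i)⁻¹ (c - c')
    have h2 := supp_card_sub_le c c'
    have h3 := hc.1
    have h4 := hc'.1
    omega
  · have h1 : A i - B.apply ((2 * x i)⁻¹ • (c - c')) = (2 * x i)⁻¹ •
        ((A.apply (coeff S (flip ∅ x)) - B.apply c) -
          (A.apply (coeff S (flip {i} x)) - B.apply c')) := by
      rw [B.apply_smul, B.apply_sub, hy]
      have : A i = (2 * x i)⁻¹ • (2 * x i) • A i := by
        rw [smul_smul, inv_mul_cancel₀ (by simpa using hx0), one_smul]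
      conv_lhs => rw [this]
      rw [← smul_sub]
      congr 1
      abel
    rw [h1, norm_smul, norm_inv, Real.norm_eq_abs, abs_mul, abs_two,
      inv_mul_le_iff₀ (by linarith)]
    refine (norm_sub_le _ _).trans ?_
    nlinarith

/-- A dictionary `B` that is compatible with sufficiently many supports agrees with `A` up to
signs and the order of columns. -/
theorem recovers_of_flipCompatible {A B : Dictionary n m} {k : ℕ} {C d e η η₀ : ℝ} (hC : 1 < C)
    (hk : 2 ≤ k) (hd : 0 ≤ d) (hdC : 128 * C ^ 2 * d ≤ 1) (he : 0 ≤ e)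
    (heη : 208 * C * k * e ≤ η₀) (hη₀ : η₀ < 1) (hη : η ≤ 1 / 20)
    (hA1 : ∀ i, ‖A i‖ = 1) (hB1 : ∀ i, ‖B i‖ = 1)
    (hA : A.NearIsometric (4 * k) d) (hB : B.NearIsometric (4 * k) d)
    (H : ∀ (i : Fin m) (T : Finset (Fin m)), i ∉ T → (T.card : ℝ) ≤ 128 * C ^ 2 →
      ∃ S : Finset (Fin m), i ∈ S ∧ Disjoint S T ∧ S.card ≤ k ∧
        FlipCompatible A B k C e η i S) : Recovers η₀ A B := by
  classical
  have hk' : (2 : ℝ) ≤ k := by exact_mod_cast hk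
  have hd1 : d ≤ 1 / 128 := by nlinarith
  have hCe : 416 * C * e ≤ 1 := by
    have : 416 * (C * e) ≤ 208 * C * k * e := by
      have : 0 ≤ C * e := by positivity
      nlinarith
    linarith
  have he1 : 416 * e ≤ 1 := by nlinarith
  have hbb := hB.boundedBelow (by linarith)
  have hrep : ∀ i, ∃ w : Fin m → ℝ, (supp w).card ≤ 2 * k ∧ ‖A i - B.apply w‖ ≤ e := by
    intro i
    obtain ⟨S, hi, -, -, hS⟩ := H i ∅ (by simp) (by rw [Finset.card_empty]; push_cast; positivity)
    exact hS.exists_representation (by omega) he hi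
  choose w hw hwA using hrep
  have hdich : ∀ i l, |w i l| ≤ (4 + 2 * C) * e ∨ 9 / 10 ≤ |w i l| := by
    intro i l
    -- The threshold `1/(4C)` makes one flip outside `T` move an entry by at most `2C/(4C) = 1/2`
    -- before errors. With `d ≤ 1/(128C²)` the Bessel bound gives `|T| ≤ 128C²`.
    set T := Finset.univ.filter fun j => j ≠ i ∧ 1 / (4 * C) ≤ |w j l| with hT
    have hcard : (T.card : ℝ) ≤ 128 * C ^ 2 := by
      have h1 := card_large_entries_le (τ := 1 / (4 * C)) (by omega) hd (by linarith)
        (by linarith) (by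
          rw [div_div, le_div_iff₀ (by positivity)]
          nlinarith [mul_nonneg hd (by linarith : 0 ≤ C)]) (by positivity) hA1 hB1 hA hB hw hwA l
        (J := T) (fun j hj => (Finset.mem_filter.mp hj).2.2)
      have h2 : 1 ≤ 128 * C ^ 2 * ((1 / (4 * C)) ^ 2 / 4 - d) := by
        have : 128 * C ^ 2 * ((1 / (4 * C)) ^ 2 / 4) = 2 := by
          field_simp
          norm_num
        rw [mul_sub, this]
        linarith
      have h3 : (0 : ℝ) < (1 / (4 * C)) ^ 2 / 4 - d := by
        by_contra! h
        nlinarith [sq_nonneg C]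
      refine le_of_mul_le_mul_right (h1.trans h2) h3
    obtain ⟨S, hi, hST, hSk, hS⟩ := H i T (by simp [hT]) hcard
    obtain ⟨F, hF0, hFb, hF⟩ := exists_chain (S.erase i)
    -- The chain through `S.erase i` has at most `|S|` patterns, and `S` itself is one more: at most
    -- `k + 1`.
    obtain ⟨x, hx, hxi, hexp⟩ := hS (insert S ((Finset.range ((S.erase i).card + 1)).image F)) (by
      refine (Finset.card_insert_le _ _).trans ?_
      have h1 := Finset.card_image_le (s := Finset.range ((S.erase i).card + 1)) (f := F)
      rw [Finset.card_range, Finset.card_erase_of_mem hi] at h1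
      have h2 : 0 < S.card := Finset.card_pos.mpr ⟨i, hi⟩
      rw [Finset.card_erase_of_mem hi]
      omega)
    have hxa := (hx i).1
    rcases entry_dichotomy (τ := 1 / (4 * C)) hbb he hw hwA hi (l := l) (fun j hj hji => by
        by_contra! hlt
        exact Finset.disjoint_left.mp hST hj 
          (Finset.mem_filter.mpr ⟨Finset.mem_univ _, hji, hlt.le⟩)) (by
        have : 2 * C * (1 / (4 * C)) = 1 / 2 := by field_simp; norm_num
        rw [this]
        nlinarith) (fun j => (hx j).2) hF0 hFb hF
        (fun p hp => hexp _ (Finset.mem_insert_of_mem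
          (Finset.mem_image_of_mem _ (Finset.mem_range.mpr (by omega)))))
        (hexp _ (Finset.mem_insert_self _ _)) with h | h
    · left
      nlinarith [abs_nonneg (w i l)]
    · right
      nlinarith [abs_nonneg (w i l)]
  -- The left side is at most `13 * C * k * e`, and `208 = 16 * 13`.
  have hρ : e + 2 * k * ((4 + 2 * C) * e) ≤ η₀ / 16 := by
    have h1 : e * 1 ≤ e * (C * k) := mul_le_mul_of_nonneg_left (by nlinarith) he
    have h2 : k * e ≤ C * (k * e) := le_mul_of_one_le_left (by positivity) hC.le
    nlinarith
  have hcol := fun i => exists_column_near (k := k) (ρ := η₀ / 16) hd1 he (by linarith)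
    (by positivity) hρ (by linarith) hB1 hB (hA1 i) (hw i) (hwA i) (hdich i)
  choose l b hb hlb using hcol
  have hη₀0 : 0 ≤ η₀ := le_trans (by positivity) heη
  -- Two columns of `A` near the same `±B l` would be within `η₀/4` of each other up to sign, but
  -- near orthogonality makes their squared distance at least `2 - 2d`.
  have hinj : Function.Injective l := by
    intro i j hij
    by_contra hne
    have h1 : ‖b i • A i - b j • A j‖ ≤ η₀ / 4 := by
      have : b i • A i - b j • A j = (B (l j) - b j • A j) - (B (l i) - b i • A i) := by
        rw [hij]; abel
      rw [this]
      refine (norm_sub_le _ _).trans ?_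
      linarith [hlb i, hlb j]
    have h2 := pow_le_pow_left₀ (norm_nonneg _) h1 2
    have h3 := hA.abs_inner_columns_le (by omega) hne
    have hbb : ∀ i, |b i| = 1 := fun i => by rcases hb i with h | h <;> simp [h]
    have h4 : |b i * (b j * inner ℝ (A i) (A j))| ≤ d := by
      rw [abs_mul, abs_mul, hbb, hbb]; simpa using h3
    rw [norm_sub_sq_real, norm_smul, norm_smul, hA1, hA1, Real.norm_eq_abs, Real.norm_eq_abs,
      hbb, hbb, inner_smul_left, inner_smul_right, conj_trivial] at h2
    have h5 := (abs_le.mp h4).2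
    nlinarith
  refine ⟨Equiv.ofBijective l (Finite.injective_iff_bijective.mp hinj), b, hb, fun i => ?_⟩
  rw [Equiv.ofBijective_apply]
  linarith [hlb i]

/-! ### Exhaustive search as a computation tree -/

lemma exists_sum_term {ι α : Type} (s : Finset α) (f : α → RealTerm ι) :
    ∃ t : RealTerm ι, ∀ Y, t.eval Y = ∑ a ∈ s, (f a).eval Y := by
  classical
  induction s using Finset.induction_on with
  | empty => exact ⟨.const 0, fun Y => by simp [RealTerm.eval]⟩
  | insert a s ha ih =>
    obtain ⟨t, ht⟩ := ih
    exact ⟨.add (f a) t, fun Y => by rw [Finset.sum_insert ha, RealTerm.eval, ht]⟩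

/-- The distance of a part of the input to a fixed vector is a term. -/
lemma exists_dist_term {ι : Type} {n : ℕ} (g : Fin n → ι) (z : EuclideanSpace ℝ (Fin n)) :
    ∃ t : RealTerm ι, ∀ Y, t.eval Y = ‖WithLp.toLp 2 (fun a => Y (g a)) - z‖ := by
  obtain ⟨t, ht⟩ := exists_sum_term Finset.univ fun a : Fin n =>
    RealTerm.mul (.sub (.input (g a)) (.const (z a))) (.sub (.input (g a)) (.const (z a)))
  refine ⟨.sqrt t, fun Y => ?_⟩
  rw [RealTerm.eval, ht, EuclideanSpace.norm_eq]
  congr 1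
  refine Finset.sum_congr rfl fun a _ => ?_
  rw [Real.norm_eq_abs, sq_abs]
  simp [RealTerm.eval, sq]

/-- Any choice among constant outputs that depends on the outcomes of finitely many comparisons
is made by an algorithm. -/
lemma exists_decision_tree {ι κ : Type} : ∀ {K : ℕ} (s t : Fin K → RealTerm ι)
    (f : (Fin K → Prop) → κ → ℝ), ∃ alg : RealAlgorithm ι κ,
      ∀ Y, alg.run Y = f fun j => (s j).eval Y ≤ (t j).eval Y
  | 0, _, _, f => ⟨.output fun j => .const (f Fin.elim0 j), fun Y => by
      funext j
      simp only [RealAlgorithm.run, RealTerm.eval]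
      exact congrFun (congrArg f (Subsingleton.elim _ _)) j⟩
  | K + 1, s, t, f => by
    obtain ⟨yes, hyes⟩ := exists_decision_tree (fun j => s j.succ) (fun j => t j.succ)
      fun p => f (Fin.cons True p)
    obtain ⟨no, hno⟩ := exists_decision_tree (fun j => s j.succ) (fun j => t j.succ)
      fun p => f (Fin.cons False p)
    refine ⟨.ifLE (s 0) (t 0) yes no, fun Y => ?_⟩
    rw [RealAlgorithm.run]
    split_ifs with h
    · rw [hyes]
      congr 1
      funext j
      refine Fin.cases ?_ (fun j => ?_) j
      · simpa using h
      · simp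
    · rw [hno]
      congr 1
      funext j
      refine Fin.cases ?_ (fun j => ?_) j
      · simpa using h
      · simp

/-- All samples in `Y` are within `e` of the image of the finite set `X` under `B`. -/
def Fits {n m N : ℕ} (X : Finset (Fin m → ℝ)) (e : ℝ) (B : Dictionary n m)
    (Y : Fin N × Fin n → ℝ) : Prop :=
  ∀ r, ∃ c ∈ X, ‖WithLp.toLp 2 (fun a => Y (r, a)) - B.apply c‖ ≤ e

/-- Searching a finite list of dictionaries for one that fits the data is an algorithm. -/
lemma exists_search_algorithm {n m N : ℕ} (Bs : Finset (Fin m × Fin n → ℝ))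
    (X : Finset (Fin m → ℝ)) (e : ℝ) : ∃ alg : RealAlgorithm (Fin N × Fin n) (Fin m × Fin n),
      ∀ Y, (∃ b ∈ Bs, Fits X e (toDictionary b) Y) →
        alg.run Y ∈ Bs ∧ Fits X e (toDictionary (alg.run Y)) Y := by
  classical
  -- One comparison for every triple of candidate, sample and code; the tree evaluates all of them
  -- and outputs a constant depending only on the outcomes.
  choose t ht using fun j : Bs × Fin N × X => exists_dist_term (fun a => ((j.2.1, a) : Fin N × Fin n))
    ((toDictionary j.1.1).apply j.2.2.1)
  let σ := Fintype.equivFin (Bs × Fin N × X)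
  let P : (Fin (Fintype.card (Bs × Fin N × X)) → Prop) → (Fin m × Fin n → ℝ) → Prop :=
    fun p b => ∃ hb : b ∈ Bs, ∀ r, ∃ c : X, p (σ (⟨b, hb⟩, r, c))
  obtain ⟨alg, halg⟩ := exists_decision_tree (fun j => t (σ.symm j)) (fun _ => .const e)
    fun p => if h : ∃ b, P p b then h.choose else 0
  refine ⟨alg, fun Y hY => ?_⟩
  have hP : ∀ b, P (fun j => (t (σ.symm j)).eval Y ≤ (RealTerm.const e).eval Y) b ↔
      b ∈ Bs ∧ Fits X e (toDictionary b) Y := by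
    intro b
    simp only [P, Fits, Equiv.symm_apply_apply, ht, RealTerm.eval, Subtype.exists, exists_prop]
  have hex : ∃ b, P (fun j => (t (σ.symm j)).eval Y ≤ (RealTerm.const e).eval Y) b :=
    hY.imp fun b hb => (hP b).mpr hb
  rw [halg, dif_pos hex]
  exact (hP _).mp hex.choose_spec

/-! ### Finite nets -/

/-- A set of vectors with entries in `[-R, R]` has a net of at most `(2 M + 1) ^ d` of its own
points, at distance at most `R / M` in every coordinate. -/
lemma exists_net {ι : Type} [Fintype ι] {K : Set (ι → ℝ)} {R : ℝ} (hR : 0 < R)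
    (hK : ∀ x ∈ K, ∀ i, |x i| ≤ R) {M : ℕ} (hM : 0 < M) :
    ∃ s : Finset (ι → ℝ), (∀ x ∈ s, x ∈ K) ∧ s.card ≤ (2 * M + 1) ^ Fintype.card ι ∧
      ∀ x ∈ K, ∃ y ∈ s, ∀ i, |x i - y i| ≤ R / M := by
  classical
  have hM' : (0 : ℝ) < M := by exact_mod_cast hM
  -- The cube is cut into cells of side `R / M`, and one point of `K` is kept from each occupied
  -- cell. The floor runs from `0` to `2M`, the value `2M` occurring at the endpoint `R`, so the
  -- reduction modulo `2M + 1` changes nothing on `K`.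
  let cell : (ι → ℝ) → ι → Fin (2 * M + 1) := fun x i => Fin.ofNat _ ⌊(x i + R) * M / R⌋₊
  obtain ⟨s, hsK, hs⟩ := K.exists_subset_bijOn cell
  have hfin : s.Finite := Set.Finite.of_finite_image (Set.toFinite _) hs.injOn
  refine ⟨hfin.toFinset, fun x hx => hsK (hfin.mem_toFinset.mp hx), ?_, fun x hx => ?_⟩
  · have := Finset.card_le_card_of_injOn (s := hfin.toFinset)
      (t := (Finset.univ : Finset (ι → Fin (2 * M + 1)))) cell (fun _ _ => Finset.mem_univ _)
      (by simpa using hs.injOn)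
    simpa using this
  · obtain ⟨y, hy, hyx⟩ := hs.surjOn (Set.mem_image_of_mem cell hx)
    refine ⟨y, hfin.mem_toFinset.mpr hy, fun i => ?_⟩
    have hrange : ∀ z ∈ K, 0 ≤ (z i + R) * M / R ∧ ⌊(z i + R) * M / R⌋₊ < 2 * M + 1 := by
      intro z hz
      have h := abs_le.mp (hK z hz i)
      have h0 : 0 ≤ (z i + R) * M / R :=
        div_nonneg (mul_nonneg (by linarith) hM'.le) hR.le
      refine ⟨h0, ?_⟩
      rw [Nat.floor_lt h0, div_lt_iff₀ hR]
      push_cast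
      nlinarith
    have h1 := congrArg Fin.val (congrFun hyx i)
    simp only [cell, Fin.val_ofNat, Nat.mod_eq_of_lt (hrange _ (hsK hy)).2,
      Nat.mod_eq_of_lt (hrange _ hx).2] at h1
    have hx1 := Nat.floor_le (hrange _ hx).1
    have hx2 := Nat.lt_floor_add_one ((x i + R) * M / R)
    have hy1 := Nat.floor_le (hrange _ (hsK hy)).1
    have hy2 := Nat.lt_floor_add_one ((y i + R) * M / R)
    rw [h1] at hy1 hy2
    have h2 : |(x i + R) * M / R - (y i + R) * M / R| ≤ 1 := by
      rw [abs_le]; constructor <;> linarith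
    have h3 : x i - y i = ((x i + R) * M / R - (y i + R) * M / R) * (R / M) := by
      field_simp
      ring
    rw [h3, abs_mul, abs_of_pos (div_pos hR hM')]
    exact mul_le_of_le_one_left (div_pos hR hM').le h2

/-! ### The probability that a fixed dictionary fits -/

lemma pi_rows_apply (D : Measure ℝ) [IsProbabilityMeasure D] (G : Fin N → Set (Fin m → ℝ)) :
    (Measure.pi fun _ : Fin N × Fin m => D).real {V | ∀ r, (fun j => V (r, j)) ∈ G r} =
      ∏ r, (Measure.pi fun _ : Fin m => D).real (G r) := by
  have h := Measure.infinitePi_map_curry (ι := Fin N) (κ := Fin m) (X := ℝ) (fun _ _ => D)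
  simp only [Measure.infinitePi_eq_pi] at h
  have hset : {V : Fin N × Fin m → ℝ | ∀ r, (fun j => V (r, j)) ∈ G r} =
      MeasurableEquiv.curry (Fin N) (Fin m) ℝ ⁻¹' Set.univ.pi G := by
    ext V
    simp only [Set.mem_ofPred_eq, Set.mem_preimage, Set.mem_univ_pi]
    rfl
  rw [hset, measureReal_def, ← MeasurableEquiv.map_apply, h, Measure.pi_pi, ENNReal.toReal_prod]
  rfl

lemma measurePreserving_flip {D : Measure ℝ} [IsProbabilityMeasure D]
    (hD : D.map (fun x => -x) = D) (F : Finset (Fin m)) :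
    MeasurePreserving (flip F) (Measure.pi fun _ : Fin m => D) (Measure.pi fun _ => D) := by
  have h := measurePreserving_pi (fun _ : Fin m => D) (fun _ => D)
    (f := fun j x => if j ∈ F then -x else x) (fun j => by
      by_cases hj : j ∈ F
      · simpa [hj] using (⟨measurable_neg, hD⟩ : MeasurePreserving (fun x : ℝ => -x) D D)
      · simpa [hj, Function.id_def] using MeasurePreserving.id D)
  exact h

lemma ae_abs_mem {C c γ₀ : ℝ} {D : Measure ℝ} (hD : IsSpikeAndSlab C c γ₀ n D) :
    ∀ᵐ x ∂D, 1 ≤ |x| ∧ |x| ≤ C := by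
  have h : ∀ᵐ x ∂D, x ∈ Set.Icc (-C) (-1) ∪ Set.Icc 1 C := mem_ae_iff.mpr hD.supported
  filter_upwards [h] with x hx
  rcases hx with hx | hx
  · rw [abs_of_nonpos (by linarith [hx.2])]
    constructor <;> linarith [hx.1, hx.2]
  · rw [abs_of_nonneg (by linarith [hx.1])]
    exact hx

lemma ae_pi_forall {ι : Type} [Fintype ι] {D : Measure ℝ} [IsProbabilityMeasure D] {p : ℝ → Prop}
    (h : ∀ᵐ x ∂D, p x) : ∀ᵐ x ∂(Measure.pi fun _ : ι => D), ∀ j, p (x j) :=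
  ae_all_iff.mpr fun j =>
    (measurePreserving_eval (fun _ : ι => D) j).quasiMeasurePreserving.ae h

/-- If `G` has probability close to `1`, then some admissible value vector that is close to `1`
at `i` stays in `G` under each of `k + 1` given patterns of sign changes. -/
lemma exists_flips_mem {C c γ₀ η : ℝ} {D : Measure ℝ}
    (hD : IsSpikeAndSlab C c γ₀ n D) (hη : 1 / Real.log n ^ c ≤ η) {k : ℕ}
    {G : Set (Fin m → ℝ)} (hG : MeasurableSet G)
    (hGp : 1 - γ₀ / (k + 1) < (Measure.pi fun _ : Fin m => D).real G) (i : Fin m)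
    (Fs : Finset (Finset (Fin m))) (hFs : Fs.card ≤ k + 1) :
    ∃ x : Fin m → ℝ, (∀ j, 1 ≤ |x j| ∧ |x j| ≤ C) ∧ |x i| ≤ 1 + η ∧ ∀ F ∈ Fs, flip F x ∈ G := by
  have := hD.isProbability
  set ν := Measure.pi fun _ : Fin m => D with hν
  by_contra! hno
  set E : Set (Fin m → ℝ) := {x | x i ∈ Set.Icc 1 (1 + η)} with hE
  have hEp : γ₀ ≤ ν.real E := by
    refine (hD.mass_near_one η hη).trans_eq ?_
    exact ((measurePreserving_eval (fun _ : Fin m => D) i).measureReal_preimage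
      measurableSet_Icc.nullMeasurableSet).symm
  have hae := ae_pi_forall (ι := Fin m) (ae_abs_mem hD)
  -- If no vector worked, `E`, of mass at least `γ₀`, would be covered by a null set and at most `k
  -- + 1` sets, each of mass below `γ₀/(k+1)` by sign symmetry.
  have hsub : E ⊆ {x | ¬ ∀ j, 1 ≤ |x j| ∧ |x j| ≤ C} ∪ ⋃ F ∈ Fs, flip F ⁻¹' Gᶜ := by
    intro x hx
    by_cases hx1 : ∀ j, 1 ≤ |x j| ∧ |x j| ≤ C
    · right
      obtain ⟨F, hF, hFG⟩ := hno x hx1 (by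
        rw [abs_of_nonneg (by linarith [hx.1])]; exact hx.2)
      simp only [Set.mem_iUnion]
      exact ⟨F, hF, hFG⟩
    · exact Or.inl hx1
  have h0 : ν.real {x | ¬ ∀ j, 1 ≤ |x j| ∧ |x j| ≤ C} = 0 := by
    rw [measureReal_def, ae_iff.mp hae, ENNReal.toReal_zero]
  have h1 : ν.real (⋃ F ∈ Fs, flip F ⁻¹' Gᶜ) ≤ ∑ F ∈ Fs, ν.real Gᶜ := by
    refine (measureReal_biUnion_finset_le _ _).trans (Finset.sum_le_sum fun F _ => ?_)
    exact ((measurePreserving_flip hD.symmetric F).measureReal_preimage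
      hG.compl.nullMeasurableSet).le
  have h2 : ν.real Gᶜ = 1 - ν.real G := probReal_compl_eq_one_sub hG
  have h3 := (measureReal_mono (μ := ν) hsub).trans (measureReal_union_le _ _)
  rw [Finset.sum_const, nsmul_eq_mul] at h1
  have hFs' : (Fs.card : ℝ) ≤ k + 1 := by exact_mod_cast hFs
  have h4 : (Fs.card : ℝ) * ν.real Gᶜ ≤ (k + 1) * ν.real Gᶜ :=
    mul_le_mul_of_nonneg_right hFs' measureReal_nonneg
  have h5 : (k + 1) * ν.real Gᶜ < γ₀ := by
    have hk : (0 : ℝ) < k + 1 := by positivity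
    rw [h2, mul_comm, ← lt_div_iff₀ hk]
    linarith
  linarith

lemma prod_le_exp {a : Fin N → ℝ} (ha0 : ∀ r, 0 ≤ a r) (ha1 : ∀ r, a r ≤ 1) {κ t : ℝ}
    (hκ : 0 ≤ κ) {R : Finset (Fin N)} (hR : t ≤ R.card) (haR : ∀ r ∈ R, a r ≤ 1 - κ) :
    ∏ r, a r ≤ Real.exp (-(κ * t)) := by
  have h1 : ∏ r, a r ≤ ∏ r ∈ R, a r := by
    have h2 : ∏ r ∈ Rᶜ, a r ≤ 1 := Finset.prod_le_one (fun r _ => ha0 r) fun r _ => ha1 r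
    rw [← Finset.prod_mul_prod_compl R a]
    exact mul_le_of_le_one_right (Finset.prod_nonneg fun r _ => ha0 r) h2
  refine h1.trans ((Finset.prod_le_prod (fun r _ => ha0 r) (g := fun _ => Real.exp (-κ))
    fun r hr => ?_).trans ?_)
  · linarith [haR r hr, Real.add_one_le_exp (-κ)]
  · rw [Finset.prod_const, ← Real.exp_nat_mul, Real.exp_le_exp]
    nlinarith

/-- The values for which a sample with support `S` is fitted by a code from `X`. -/
def fitSet (A B : Dictionary n m) (X : Finset (Fin m → ℝ)) (e : ℝ) (S : Finset (Fin m)) :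
    Set (Fin m → ℝ) :=
  {x | ∃ c ∈ X, ‖A.apply (coeff S x) - B.apply c‖ ≤ e}

lemma measurableSet_fitSet (A B : Dictionary n m) (X : Finset (Fin m → ℝ)) (e : ℝ)
    (S : Finset (Fin m)) : MeasurableSet (fitSet A B X e S) := by
  have hcont : Continuous fun x : Fin m → ℝ => A.apply (coeff S x) := by
    unfold Dictionary.apply coeff
    refine continuous_finsetSum _ fun i _ => ?_
    split_ifs <;> fun_prop
  have : fitSet A B X e S = ⋃ c ∈ X, {x | ‖A.apply (coeff S x) - B.apply c‖ ≤ e} := by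
    ext x; simp [fitSet]
  rw [this]
  exact Finset.measurableSet_biUnion _ fun c _ =>
    (isClosed_le (hcont.sub continuous_const).norm continuous_const).measurableSet

lemma fits_samples_iff {A B : Dictionary n m} {X : Finset (Fin m → ℝ)} {e : ℝ}
    {S : Fin N → Finset (Fin m)} {V : Fin N × Fin m → ℝ} :
    Fits X e B (samples A S V) ↔ ∀ r, (fun j => V (r, j)) ∈ fitSet A B X e (S r) :=
  Iff.rfl

/-- A dictionary that does not agree with `A` fits all samples with small probability only. -/
theorem measureReal_fits_le {A B : Dictionary n m} {k : ℕ} {C c γ₀ d e η η₀ q t : ℝ}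
    (hC : 1 < C) (hk : 2 ≤ k) (hd : 0 ≤ d) (hdC : 128 * C ^ 2 * d ≤ 1) (he : 0 ≤ e)
    (heη : 208 * C * k * e ≤ η₀) (hη₀ : η₀ < 1) (hη : η ≤ 1 / 20)
    (hA1 : ∀ i, ‖A i‖ = 1) (hB1 : ∀ i, ‖B i‖ = 1)
    (hA : A.NearIsometric (4 * k) d) (hB : B.NearIsometric (4 * k) d)
    {X : Finset (Fin m → ℝ)} (hX : ∀ c ∈ X, IsCode k C c) {D : Measure ℝ}
    (hD : IsSpikeAndSlab C c γ₀ n D) (hγ : 0 ≤ γ₀) (hηn : 1 / Real.log n ^ c ≤ η)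
    {S : Fin N → Finset (Fin m)} (hS : ∀ r, (S r).card ≤ k) (hSc : SupportCondition q t S)
    (ht : 128 * C ^ 2 ≤ t) (hrec : ¬ Recovers η₀ A B) :
    (Measure.pi fun _ : Fin N × Fin m => D).real {V | Fits X e B (samples A S V)} ≤
      Real.exp (-(γ₀ / (k + 1) * (q * N))) := by
  have := hD.isProbability
  simp only [fits_samples_iff]
  rw [pi_rows_apply D fun r => fitSet A B X e (S r)]
  by_contra! hlt
  -- If the bound fails, then for each `i` and `T` some row whose support contains `i` and avoids
  -- `T` has fit probability above `1 - γ₀/(k+1)`; otherwise the at least `q N` factors for such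
  -- rows would already give the bound.
  refine hrec (recovers_of_flipCompatible hC hk hd hdC he heη hη₀ hη hA1 hB1 hA hB
    fun i T hiT hT => ?_)
  by_contra! hno
  refine hlt.not_ge (prod_le_exp (fun _ => measureReal_nonneg) (fun _ => measureReal_le_one)
    (by positivity) (R := Finset.univ.filter fun r => i ∈ S r ∧ Disjoint (S r) T) ?_
    fun r hr => ?_)
  · refine (hSc i T hiT (hT.trans ht)).trans_eq ?_
    rw [← Set.ncard_coe_finset]
    simp
  · by_contra! hbig
    obtain ⟨hi, hdis⟩ := (Finset.mem_filter.mp hr).2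
    refine hno (S r) hi hdis (hS r) fun Fs hFs => ?_
    obtain ⟨x, hx, hxi, hF⟩ := exists_flips_mem hD hηn
      (measurableSet_fitSet A B X e (S r)) hbig i Fs hFs
    refine ⟨x, hx, hxi, fun F hFm => ?_⟩
    obtain ⟨c, hc, hyc⟩ := hF F hFm
    exact ⟨c, hX c hc, hyc⟩

/-! ### Discretization and the union bound -/

lemma euclidean_norm_le_of_coord_le {v : EuclideanSpace ℝ (Fin n)} {ρ : ℝ} (hρ : 0 ≤ ρ)
    (hv : ∀ a, |v a| ≤ ρ) : ‖v‖ ≤ n * ρ := by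
  refine le_of_sq_le_sq ?_ (by positivity)
  rw [EuclideanSpace.norm_sq_eq]
  have h1 : ∑ a, ‖v a‖ ^ 2 ≤ ∑ _a : Fin n, ρ ^ 2 :=
    Finset.sum_le_sum fun a _ => pow_le_pow_left₀ (norm_nonneg _) (hv a) 2
  rw [Finset.sum_const, Finset.card_univ, Fintype.card_fin, nsmul_eq_mul] at h1
  refine h1.trans ?_
  rw [mul_pow]
  refine mul_le_mul_of_nonneg_right ?_ (sq_nonneg ρ)
  exact_mod_cast Nat.le_self_pow two_ne_zero n

lemma isCode_coeff {k : ℕ} {C : ℝ} {S : Finset (Fin m)} (hS : S.card ≤ k) {v : Fin m → ℝ}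
    (hv : ∀ j, 1 ≤ |v j| ∧ |v j| ≤ C) : IsCode k C (coeff S v) := by
  refine ⟨(Finset.card_le_card fun j hj => ?_).trans hS, fun l => ?_⟩
  · by_contra h
    simp [coeff, h] at hj
  · by_cases hl : l ∈ S
    · exact Or.inr (by simpa [coeff, hl] using hv l)
    · exact Or.inl (by simp [coeff, hl])

/-- Writes `A x - B c = (A - B) x + B (x - c)`: sparsity of `x` leaves `k` terms in the first part,
and the second is bounded over all `m` columns. -/
lemma norm_apply_sub_apply_le {A B : Dictionary n m} {k : ℕ} {C ρ ρ' : ℝ} (hρ : 0 ≤ ρ)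
    (hAB : ∀ i, ‖A i - B i‖ ≤ ρ) (hB1 : ∀ i, ‖B i‖ = 1) {x c : Fin m → ℝ} (hC : 0 ≤ C)
    (hx : (supp x).card ≤ k) (hxC : ∀ j, |x j| ≤ C) (hxc : ∀ j, |x j - c j| ≤ ρ') :
    ‖A.apply x - B.apply c‖ ≤ k * (C * ρ) + m * ρ' := by
  have h1 : A.apply x - B.apply c =
      ∑ j ∈ supp x, x j • (A j - B j) + ∑ j, (x j - c j) • B j := by
    have h2 : ∑ j ∈ supp x, x j • (A j - B j) = ∑ j, x j • (A j - B j) :=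
      Finset.sum_subset (Finset.subset_univ _) fun j _ hj => by
        rw [mem_supp, not_not] at hj
        rw [hj, zero_smul]
    rw [h2, Dictionary.apply, Dictionary.apply, ← Finset.sum_sub_distrib,
      ← Finset.sum_add_distrib]
    refine Finset.sum_congr rfl fun j _ => ?_
    module
  rw [h1]
  refine (norm_add_le _ _).trans (add_le_add ?_ ?_)
  · refine (norm_sum_le_of_le _ (n := fun _ => C * ρ) fun j _ => ?_).trans ?_
    · rw [norm_smul]
      exact mul_le_mul (hxC j) (hAB j) (norm_nonneg _) hC
    · rw [Finset.sum_const, nsmul_eq_mul]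
      exact mul_le_mul_of_nonneg_right (by exact_mod_cast hx) (by positivity)
  · refine (norm_sum_le_of_le _ (n := fun _ => ρ') fun j _ => ?_).trans ?_
    · rw [norm_smul, hB1, mul_one]
      exact hxc j
    · simp

/-- The size of this net is immaterial, since the union bound runs over dictionaries only.
Finiteness makes the search a finite tree and `fitSet` a finite union of closed sets. -/
lemma exists_code_net (m k : ℕ) {C ρ : ℝ} (hC : 0 < C) (hρ : 0 < ρ) :
    ∃ X : Finset (Fin m → ℝ), (∀ c ∈ X, IsCode k C c) ∧
      ∀ x : Fin m → ℝ, IsCode k C x → ∃ c ∈ X, ∀ j, |x j - c j| ≤ ρ := by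
  obtain ⟨M, hM⟩ := exists_nat_gt (C / ρ)
  have hM0 : (0 : ℝ) < M := (div_pos hC hρ).trans hM
  obtain ⟨X, hX, -, hnet⟩ := exists_net (K := {x : Fin m → ℝ | IsCode k C x}) hC (fun x hx i => by
    rcases hx.2 i with h | h
    · rw [h, abs_zero]; exact hC.le
    · exact h.2) (M := M) (by exact_mod_cast hM0)
  refine ⟨X, hX, fun x hx => ?_⟩
  obtain ⟨c, hc, hxc⟩ := hnet x hx
  refine ⟨c, hc, fun j => (hxc j).trans ?_⟩
  rw [div_le_iff₀ hM0, mul_comm]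
  exact ((div_lt_iff₀ hρ).mp hM).le

/-- The net points are themselves unit-norm RIP dictionaries, so the structural argument applies to
every candidate. Its size is the one that the number of samples has to beat. -/
lemma exists_dictionary_net (n m k : ℕ) (δ : ℝ) {M : ℕ} (hM : 0 < M) :
    ∃ Bs : Finset (Fin m × Fin n → ℝ),
      (∀ b ∈ Bs, (∀ i, ‖toDictionary b i‖ = 1) ∧ (toDictionary b).IsRIP k δ) ∧
      Bs.card ≤ (2 * M + 1) ^ (m * n) ∧
      ∀ A : Dictionary n m, (∀ i, ‖A i‖ = 1) → A.IsRIP k δ →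
        ∃ b ∈ Bs, ∀ i, ‖A i - toDictionary b i‖ ≤ n * (1 / M) := by
  obtain ⟨Bs, hBs, hcard, hnet⟩ := exists_net (R := 1)
    (K := {b : Fin m × Fin n → ℝ | (∀ i, ‖toDictionary b i‖ = 1) ∧ (toDictionary b).IsRIP k δ})
    one_pos (fun b hb p => by
      have := PiLp.norm_apply_le (toDictionary b p.1) p.2
      rwa [hb.1 p.1] at this) hM
  refine ⟨Bs, hBs, by simpa using hcard, fun A hA1 hA => ?_⟩
  obtain ⟨b, hb, hAb⟩ := hnet (fun p => A p.1 p.2) ⟨hA1, hA⟩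
  exact ⟨b, hb, fun i => euclidean_norm_le_of_coord_le (by positivity) fun a => hAb (i, a)⟩

/-- Exhaustive search for a dictionary that fits the data succeeds with high probability, once
the number of samples beats the logarithm of the size of a net of dictionaries. -/
theorem exists_recovering_algorithm {n m k N M : ℕ} {C c γ₀ δ₀ e η η₀ q t : ℝ}
    (hC : 1 < C) (hk : 2 ≤ k) (hδ₀ : 0 ≤ δ₀) (hdC : 128 * C ^ 2 * (768 * δ₀) ≤ 1) (he : 0 < e)
    (heη : 208 * C * k * e ≤ η₀) (hη₀ : η₀ < 1) (hη : η ≤ 1 / 20) (hm : 0 < m) (hM : 0 < M)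
    (hMe : k * (C * (n * (1 / M))) ≤ e / 2) (hγ : 0 ≤ γ₀) (hηn : 1 / Real.log n ^ c ≤ η)
    (ht : 128 * C ^ 2 ≤ t)
    (hN : n + m * n * Real.log (2 * M + 1) ≤ γ₀ / (k + 1) * (q * N)) :
    ∃ alg : RealAlgorithm (Fin N × Fin n) (Fin m × Fin n),
      ∀ (A : Dictionary n m) (D : Measure ℝ) (S : Fin N → Finset (Fin m)),
        (∀ i, ‖A i‖ = 1) → A.IsRIP k δ₀ → IsSpikeAndSlab C c γ₀ n D → (∀ r, (S r).card ≤ k) →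
        SupportCondition q t S →
        1 - Real.exp (-(n : ℝ)) ≤ (Measure.pi fun _ : Fin N × Fin m => D).real
          {V | Recovers η₀ A (toDictionary (alg.run (samples A S V)))} := by
  classical
  have hm' : (0 : ℝ) < m := by exact_mod_cast hm
  obtain ⟨X, hX, hXnet⟩ := exists_code_net m k (by linarith : 0 < C)
    (by positivity : 0 < e / 2 / m)
  obtain ⟨Bs, hBs, hcard, hnet⟩ := exists_dictionary_net n m k δ₀ hM
  obtain ⟨alg, halg⟩ := exists_search_algorithm (N := N) Bs X e
  refine ⟨alg, fun A D S hA1 hA hD hS hSc => ?_⟩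
  have := hD.isProbability
  set μ := Measure.pi fun _ : Fin N × Fin m => D with hμ
  have hδ1 : δ₀ ≤ 1 := by nlinarith
  -- Some net dictionary that does not recover `A` fits the data. Outside this event and a null set
  -- the search is successful, because the net point near `A` fits.
  set bad : Set (Fin N × Fin m → ℝ) :=
    ⋃ b ∈ Bs.filter fun b => ¬ Recovers η₀ A (toDictionary b),
      {V | Fits X e (toDictionary b) (samples A S V)} with hbad
  have hbadm : MeasurableSet bad := by
    refine Finset.measurableSet_biUnion _ fun b _ => ?_
    simp only [fits_samples_iff, Set.ofPred_forall]
    refine MeasurableSet.iInter fun r => ?_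
    exact (measurableSet_fitSet A (toDictionary b) X e (S r)).preimage (by fun_prop)
  have hgood : badᶜ ≤ᵐ[μ] {V | Recovers η₀ A (toDictionary (alg.run (samples A S V)))} := by
    filter_upwards [ae_pi_forall (ι := Fin N × Fin m) (ae_abs_mem hD)] with V hV hVb
    obtain ⟨b₀, hb₀, hAb₀⟩ := hnet A hA1 hA
    obtain ⟨hrun, hfit⟩ := halg (samples A S V) ⟨b₀, hb₀, fun r => by
      have hx := isCode_coeff (hS r) (v := fun j => V (r, j)) fun j => hV (r, j)
      obtain ⟨x, hxX, hxc⟩ := hXnet _ hx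
      refine ⟨x, hxX, ?_⟩
      have h1 := norm_apply_sub_apply_le (by positivity) hAb₀ (hBs b₀ hb₀).1
        (by linarith : 0 ≤ C) hx.1 (fun j => by
          rcases hx.2 j with h | h
          · rw [h, abs_zero]; linarith
          · exact h.2) hxc
      have h2 : (m : ℝ) * (e / 2 / m) = e / 2 := by field_simp
      rw [h2] at h1
      refine le_trans (le_of_eq ?_) (h1.trans (by linarith))
      rfl⟩
    by_contra hrec
    refine hVb ?_
    exact Set.mem_iUnion₂.mpr
      ⟨alg.run (samples A S V), Finset.mem_filter.mpr ⟨hrun, hrec⟩, hfit⟩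
  have hbadp : μ.real bad ≤ Real.exp (-(n : ℝ)) := by
    have h1 : ∀ b ∈ Bs.filter fun b => ¬ Recovers η₀ A (toDictionary b),
        μ.real {V | Fits X e (toDictionary b) (samples A S V)} ≤
          Real.exp (-(γ₀ / (k + 1) * (q * N))) := by
      intro b hb
      obtain ⟨hb, hrec⟩ := Finset.mem_filter.mp hb
      exact measureReal_fits_le hC hk (by positivity) hdC he.le heη hη₀ hη hA1 (hBs b hb).1
        (hA.nearIsometric_four_mul hk hδ₀ hδ1) ((hBs b hb).2.nearIsometric_four_mul hk hδ₀ hδ1)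
        hX hD hγ hηn hS hSc ht hrec
    refine (measureReal_biUnion_finset_le _ _).trans ((Finset.sum_le_sum h1).trans ?_)
    rw [Finset.sum_const, nsmul_eq_mul]
    have h2 : ((Bs.filter fun b => ¬ Recovers η₀ A (toDictionary b)).card : ℝ) ≤
        Real.exp (m * n * Real.log (2 * M + 1)) := by
      have h3 : ((2 * M + 1 : ℝ)) ^ (m * n) = Real.exp (m * n * Real.log (2 * M + 1)) := by
        rw [← Nat.cast_mul, Real.exp_nat_mul, Real.exp_log (by positivity)]
      rw [← h3]
      exact_mod_cast (Finset.card_filter_le _ _).trans hcard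
    refine (mul_le_mul_of_nonneg_right h2 (Real.exp_pos _).le).trans ?_
    rw [← Real.exp_add, Real.exp_le_exp]
    linarith
  -- Measurability of `bad` suffices; the recovery event is only compared with `badᶜ` by
  -- monotonicity of the outer measure.
  calc 1 - Real.exp (-(n : ℝ)) ≤ 1 - μ.real bad := by linarith
    _ = μ.real badᶜ := (probReal_compl_eq_one_sub hbadm).symm
    _ ≤ _ := ENNReal.toReal_mono (measure_ne_top _ _) (measure_mono_ae hgood)

/-! ### Choice of constants -/

lemma one_lt_log_three : 1 < Real.log 3 := by
  linarith [Real.log_three_gt_d9]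

lemma exists_forall_one_div_log_rpow_le {c ε : ℝ} (hc : 0 < c) (hε : 0 < ε) :
    ∃ N₀ : ℝ, ∀ x, N₀ ≤ x → 1 / Real.log x ^ c ≤ ε := by
  have h := ((tendsto_rpow_atTop hc).comp Real.tendsto_log_atTop).eventually_ge_atTop (1 / ε)
  obtain ⟨N₀, hN₀⟩ := Filter.eventually_atTop.mp h
  refine ⟨N₀, fun x hx => ?_⟩
  have h1 := hN₀ x hx
  have h2 : 0 < Real.log x ^ c := (one_div_pos.mpr hε).trans_le h1
  rw [Function.comp_apply, div_le_iff₀ hε] at h1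
  rw [div_le_iff₀ h2]
  linarith

/-- The role of a large exponent: for `m ≥ 3` the hypothesis `k < n / log^(2c₁) m` then forces `n ≥
N₀`, so that `1 / log^c n` is small enough for the mass near `1` to be available. -/
lemma exists_exponent (N₀ : ℝ) : ∃ c₁ : ℝ, 1 ≤ c₁ ∧ N₀ ≤ Real.log 3 ^ (2 * c₁) := by
  have h1 := tendsto_rpow_atTop_of_base_gt_one _ one_lt_log_three
  obtain ⟨y, hy⟩ := Filter.eventually_atTop.mp (h1.eventually_ge_atTop N₀)
  exact ⟨max 1 y, le_max_left _ _, hy _ (by linarith [le_max_right 1 y, le_max_left 1 y])⟩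

/-- In dimension at most one, two unit columns are never nearly orthogonal. -/
lemma not_isRIP_of_le_one {n m k : ℕ} {A : Dictionary n m} {δ : ℝ} (hn : n ≤ 1) (hm : 2 ≤ m)
    (hk : 2 ≤ k) (hδ0 : 0 ≤ δ) (hδ : 768 * δ < 1) (hA1 : ∀ i, ‖A i‖ = 1) : ¬ A.IsRIP k δ := by
  intro hA
  have h := (hA.nearIsometric_four_mul hk hδ0 (by linarith)).abs_inner_columns_le (by omega)
    (i := ⟨0, by omega⟩) (j := ⟨1, by omega⟩) (by simp)
  have h0 := hA1 ⟨0, by omega⟩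
  have h1 := hA1 ⟨1, by omega⟩
  interval_cases n
  · rw [Subsingleton.elim (A _) 0, norm_zero] at h0
    exact zero_ne_one h0
  · rw [EuclideanSpace.norm_eq, Fin.sum_univ_one, Real.sqrt_sq (norm_nonneg _),
      Real.norm_eq_abs] at h0 h1
    rw [PiLp.inner_apply, Fin.sum_univ_one] at h
    simp only [RCLike.inner_apply, conj_trivial, abs_mul] at h
    rw [h0, h1] at h
    linarith

/-- The argument of the logarithm is at most `835 C² m³ / η₀`, where `835 = 2 * 416 + 3` absorbs the
rounding. The `4` counts three times `log m` and once `log (1/η₀) ≤ 1/η₀`. -/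
lemma log_net_size_le {C η₀ : ℝ} (hC : 1 < C) (hη₀ : 0 < η₀) (hη₀1 : η₀ < 1) {n m k : ℕ}
    (hk : 2 ≤ k) (hkn : k ≤ n) (hnm : n < m) (hm : 1 ≤ Real.log m) :
    Real.log (2 * ⌈416 * C ^ 2 * k ^ 2 * n / η₀⌉₊ + 1) ≤
      (Real.log (835 * C ^ 2) + 4) * (Real.log m / η₀ ^ 3) := by
  have hk' : (2 : ℝ) ≤ k := by exact_mod_cast hk
  have hkn' : (k : ℝ) ≤ n := by exact_mod_cast hkn
  have hnm' : (n : ℝ) ≤ m := by exact_mod_cast hnm.le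
  have hC2 : 1 < C ^ 2 := by nlinarith
  have h1 : 416 * C ^ 2 * k ^ 2 * n / η₀ ≤ 416 * (C ^ 2 * m ^ 3 / η₀) := by
    rw [mul_div_assoc', div_le_div_iff_of_pos_right hη₀]
    have : (k : ℝ) ^ 2 * n ≤ m ^ 2 * m := by
      have : (k : ℝ) ≤ m := hkn'.trans hnm'
      gcongr
    nlinarith
  have h2 : 1 ≤ C ^ 2 * m ^ 3 / η₀ := by
    rw [one_le_div hη₀]
    have : (1 : ℝ) ≤ m ^ 3 := one_le_pow₀ (by linarith)
    nlinarith
  have h3 := (Nat.ceil_lt_add_one (by positivity : 0 ≤ 416 * C ^ 2 * k ^ 2 * n / η₀)).le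
  have h4 : (2 * ⌈416 * C ^ 2 * k ^ 2 * n / η₀⌉₊ + 1 : ℝ) ≤ 835 * C ^ 2 * (m ^ 3 * η₀⁻¹) := by
    have : 835 * C ^ 2 * (m ^ 3 * η₀⁻¹) = 835 * (C ^ 2 * m ^ 3 / η₀) := by
      rw [div_eq_mul_inv]; ring
    rw [this]
    linarith
  have hm0 : (0 : ℝ) < m := by linarith
  refine (Real.log_le_log (by positivity) h4).trans ?_
  rw [Real.log_mul (x := 835 * C ^ 2) (by positivity) (by positivity),
    Real.log_mul (x := (m : ℝ) ^ 3) (by positivity) (by positivity), Real.log_pow]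
  have h5 : Real.log η₀⁻¹ ≤ η₀⁻¹ := (Real.log_le_sub_one_of_pos (by positivity)).trans (by linarith)
  have h6 : 0 ≤ Real.log (835 * C ^ 2) := Real.log_nonneg (by nlinarith)
  have h7 : η₀ ^ 3 ≤ η₀ := pow_le_of_le_one hη₀.le hη₀1.le three_ne_zero
  have h8 : Real.log m ≤ Real.log m / η₀ ^ 3 := by
    rw [le_div_iff₀ (by positivity)]
    nlinarith
  have h9 : η₀⁻¹ ≤ Real.log m / η₀ ^ 3 := by
    rw [inv_eq_one_div, div_le_div_iff₀ hη₀ (by positivity)]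
    nlinarith
  push_cast
  nlinarith

/-- The number of samples exceeds the logarithm of the size of the net of dictionaries. -/
lemma sample_bound {n m k N l L η₀ γ₀ q K c₁ b : ℝ} (hn : 0 < n) (hm : 1 ≤ m) (hk : 1 ≤ k)
    (hη₀ : 0 < η₀) (hη₀1 : η₀ < 1) (hγ₀ : 0 < γ₀) (hq : 0 < q) (hl : 1 ≤ l) (hc₁ : 1 ≤ c₁)
    (hL : 1 ≤ L) (hK : 0 ≤ K) (hb : b ≤ (K + 4) * (l / η₀ ^ 3))
    (hN : 2 * (K + 5) * k * n * m * l ^ c₁ * L / (η₀ ^ 3 * γ₀ * q) ≤ N) :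
    n + m * n * b ≤ γ₀ / (k + 1) * (q * N) := by
  have h2 : l ≤ l ^ c₁ * L := by
    have := Real.rpow_le_rpow_of_exponent_le hl hc₁
    rw [Real.rpow_one] at this
    nlinarith
  set R := l / η₀ ^ 3 with hR
  have h3 : 1 ≤ R := by
    rw [hR, one_le_div (by positivity)]
    exact (pow_le_one₀ hη₀.le hη₀1.le).trans hl
  have h4 : (K + 5) * (n * m * R) ≤ γ₀ / (k + 1) * (q * N) := by
    have h5 : γ₀ / (k + 1) * (q * (2 * (K + 5) * k * n * m * l / (η₀ ^ 3 * γ₀ * q))) ≤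
        γ₀ / (k + 1) * (q * N) := by
      refine mul_le_mul_of_nonneg_left (mul_le_mul_of_nonneg_left (le_trans ?_ hN) hq.le)
        (by positivity)
      rw [div_le_div_iff_of_pos_right (by positivity), mul_assoc _ (l ^ c₁)]
      exact mul_le_mul_of_nonneg_left h2 (by positivity)
    refine le_trans ?_ h5
    -- The factor `2` in the sample size compensates for `k / (k+1)`, which is at least `1/2`.
    have h6 : γ₀ / (k + 1) * (q * (2 * (K + 5) * k * n * m * l / (η₀ ^ 3 * γ₀ * q))) =
        (K + 5) * (n * m * R) * (2 * k / (k + 1)) := by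
      rw [hR]; field_simp
    rw [h6]
    refine le_mul_of_one_le_right (by positivity) ?_
    rw [one_le_div (by positivity)]
    linarith
  have h7 : m * n * b ≤ m * n * ((K + 4) * R) := mul_le_mul_of_nonneg_left hb (by positivity)
  have h8 : n * 1 ≤ n * (m * R) := mul_le_mul_of_nonneg_left (by nlinarith) hn.le
  nlinarith

end DictLearning

open DictLearning

theorem corollary3p2 (C : ℝ) (hC : 1 < C) (c : ℝ) (hc : 0 < c) :
    ∃ c₀ c₁ c₂ c₄ c₅ c₆ : ℝ,
      0 < c₀ ∧ 0 < c₁ ∧ 0 < c₂ ∧ 0 < c₄ ∧ 0 < c₅ ∧ 0 < c₆ ∧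
      ∀ (n m k N : ℕ) (η₀ γ₀ q κ₀ : ℝ),
        n < m → 2 ≤ k → (k : ℝ) < n / Real.log m ^ (2 * c₁) →
        0 < η₀ → η₀ < 1 → 0 < γ₀ → γ₀ < 1 → 0 < q → q ≤ 1 →
        κ₀ = c₀ * γ₀ * Real.log m ^ (-c₁) * q →
        c₂ * k * n * m * Real.log m ^ c₁ * Real.log (1 / κ₀) / (η₀ ^ 3 * γ₀ * q) ≤ N →
        ∃ alg : DictLearning.RealAlgorithm (Fin N × Fin n) (Fin m × Fin n),
          ∀ (A : DictLearning.Dictionary n m) (δ : ℝ) (D : MeasureTheory.Measure ℝ)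
            (S : Fin N → Finset (Fin m)),
            (∀ i, ‖A i‖ = 1) →
            δ < c₅ / (Real.log (1 / κ₀) * Real.log m ^ c₆) →
            A.IsRIP k δ →
            DictLearning.IsSpikeAndSlab C c γ₀ n D →
            (∀ r, (S r).card ≤ k) →
            DictLearning.SupportCondition q (c₄ * Real.log m ^ (2 * c₁)) S →
            1 - Real.exp (-(n : ℝ)) ≤
              (MeasureTheory.Measure.pi (fun _ : Fin N × Fin m => D)).real
                {V | DictLearning.Recovers η₀ A
                  (DictLearning.toDictionary (alg.run (DictLearning.samples A S V)))} := by
  obtain ⟨N₀, hN₀⟩ := exists_forall_one_div_log_rpow_le hc (by norm_num : (0 : ℝ) < 1 / 20)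
  obtain ⟨c₁, hc₁, hNc₁⟩ := exists_exponent N₀
  have hC2 : 1 < C ^ 2 := by nlinarith
  have hK : 0 ≤ Real.log (835 * C ^ 2) := Real.log_nonneg (by nlinarith)
  -- As `log m ≥ 1/2` for `m ≥ 2`, the first constant ensures `log (1/κ₀) ≥ 1`. The bound on
  -- supports avoiding `T` needs `128C²`, the size bound for `T`. The `2` in the fifth constant
  -- again pays for `log m ≥ 1/2`, and the rest of it gives `128C² * 768δ ≤ 1`.
  refine ⟨2 ^ (-c₁) * Real.exp (-1), c₁, 2 * (Real.log (835 * C ^ 2) + 5), 128 * C ^ 2,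
    1 / (2 * (768 * (128 * C ^ 2))), 1, by positivity, by linarith, by positivity, by positivity,
    by positivity, one_pos, ?_⟩
  intro n m k N η₀ γ₀ q κ₀ hnm hk hkn hη₀ hη₀1 hγ₀ hγ₀1 hq hq1 hκ₀ hN
  have hk' : (2 : ℝ) ≤ k := by exact_mod_cast hk
  have hn0 : 0 < n := by
    rcases Nat.eq_zero_or_pos n with rfl | h
    · rw [Nat.cast_zero, zero_div] at hkn
      linarith
    · exact h
  have hm2 : (2 : ℝ) ≤ m := by exact_mod_cast (by omega : 2 ≤ m)
  have hlog : 1 / 2 ≤ Real.log m :=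
    (by linarith [Real.log_two_gt_d9] : 1 / 2 ≤ Real.log 2).trans
      (Real.log_le_log (by norm_num) hm2)
  have hlog0 : 0 < Real.log m := by linarith
  have hκ0 : 0 < κ₀ := by rw [hκ₀]; positivity
  have hL : 1 ≤ Real.log (1 / κ₀) := by
    have h1 : 2 ^ (-c₁) * Real.log m ^ (-c₁) ≤ 1 := by
      rw [← Real.mul_rpow (by norm_num) hlog0.le]
      exact Real.rpow_le_one_of_one_le_of_nonpos (by linarith) (by linarith)
    have h2 : γ₀ * q ≤ 1 := mul_le_one₀ hγ₀1.le hq.le hq1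
    have h3 : κ₀ ≤ Real.exp (-1) := by
      have h4 : κ₀ = (2 ^ (-c₁) * Real.log m ^ (-c₁)) * (γ₀ * q) * Real.exp (-1) := by
        rw [hκ₀]; ring
      rw [h4]
      refine mul_le_of_le_one_left (Real.exp_pos _).le ?_
      exact mul_le_one₀ h1 (by positivity) h2
    have h5 := Real.log_le_log hκ0 h3
    rw [Real.log_exp] at h5
    rw [one_div, Real.log_inv]
    linarith
  set δ₀ : ℝ := 1 / (768 * (128 * C ^ 2)) with hδ₀
  have hδ₀0 : 0 < δ₀ := by positivity
  have hδ₀C : 128 * C ^ 2 * (768 * δ₀) = 1 := by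
    rw [hδ₀]; field_simp
  have hδ : ∀ δ, δ < 1 / (2 * (768 * (128 * C ^ 2))) / (Real.log (1 / κ₀) * Real.log m ^ (1 : ℝ)) →
      δ ≤ δ₀ := by
    intro δ h
    refine h.le.trans ?_
    rw [Real.rpow_one, div_le_iff₀ (by positivity), hδ₀, one_div, mul_inv, ← one_div,
      mul_comm, ← one_div]
    refine mul_le_mul_of_nonneg_left ?_ (by positivity)
    nlinarith
  -- For `m = 2` one has `n = 1`, and no dictionary satisfies the hypotheses, so any output will do.
  rcases lt_or_ge m 3 with hm3 | hm3
  · refine ⟨.output fun _ => .const 0, fun A δ D S hA1 hδlt hA => ?_⟩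
    exact absurd (hA.mono (hδ δ hδlt)) (not_isRIP_of_le_one (by omega) (by omega) hk hδ₀0.le
      (by nlinarith) hA1)
  have hlog1 : Real.log 3 ≤ Real.log m :=
    Real.log_le_log (by norm_num) (by exact_mod_cast hm3)
  have hlogm : 1 ≤ Real.log m := one_lt_log_three.le.trans hlog1
  have hpow1 : 1 ≤ Real.log m ^ (2 * c₁) := Real.one_le_rpow hlogm (by linarith)
  rw [lt_div_iff₀ (by linarith)] at hkn
  have hkn' : k ≤ n := by
    have : (k : ℝ) ≤ n := by nlinarith
    exact_mod_cast this
  have hnN : N₀ ≤ n := by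
    have : Real.log 3 ^ (2 * c₁) ≤ Real.log m ^ (2 * c₁) :=
      Real.rpow_le_rpow (by linarith [one_lt_log_three]) hlog1 (by linarith)
    nlinarith
  have hn' : (1 : ℝ) ≤ n := by exact_mod_cast hn0
  have hM : 0 < 416 * C ^ 2 * k ^ 2 * n / η₀ := by positivity
  -- The tolerance `e` is the largest with `208 * C * k * e ≤ η₀`. The mesh `1/M` is chosen so that
  -- replacing `A` by its net point costs at most `e/2`; the other `e/2` is left for the code net.
  obtain ⟨alg, halg⟩ := exists_recovering_algorithm (n := n) (m := m) (N := N)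
    (M := ⌈416 * C ^ 2 * k ^ 2 * n / η₀⌉₊) (e := η₀ / (208 * C * k)) (η := 1 / 20) (q := q)
    (t := 128 * C ^ 2 * Real.log m ^ (2 * c₁)) hC hk hδ₀0.le hδ₀C.le (by positivity)
    (by rw [mul_div_cancel₀ _ (by positivity)]) hη₀1 le_rfl (by omega) (Nat.ceil_pos.mpr hM) (by
      have h1 := Nat.le_ceil (416 * C ^ 2 * k ^ 2 * n / η₀)
      have h2 := one_div_le_one_div_of_le hM h1
      refine (mul_le_mul_of_nonneg_left (mul_le_mul_of_nonneg_left (mul_le_mul_of_nonneg_left h2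
        (by positivity)) (by linarith)) (by positivity)).trans_eq ?_
      field_simp
      norm_num) hγ₀.le (hN₀ n hnN) (le_mul_of_one_le_right (by positivity) hpow1) (by
      have h1 := log_net_size_le hC hη₀ hη₀1 hk hkn' hnm hlogm
      exact sample_bound (by exact_mod_cast hn0) (by linarith) (by linarith) hη₀ hη₀1 hγ₀ hq hlogm
        hc₁ hL hK h1 hN)
  exact ⟨alg, fun A δ D S hA1 hδlt hA hD hS hSc =>
    halg A D S hA1 (hA.mono (hδ δ hδlt)) hD hS hSc⟩
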